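/- Let $\mathcal M\subset\mathbb R^m$ be a connected compact smoothly embedded submanifold on which the Euclidean norm is constant and on which a subgroup of the orthogonal group $O(m)$ acts transitively (each of its elements mapping $\mathcal M$ onto itself). Assume that, for every $b\in\mathbb R^m$, all local maxima of the linear function $c\mapsto c^Tb$ over $\mathcal M$ are global maxima over $\mathcal M$. Let $A=[a_{jk}]\in\mathbb R^{N\times N}$ be the adjacency matrix of a weighted undirected graph $G$ ($A=A^T$, $a_{jk}\ge 0$, $a_{kk}=0$), let $\alpha\in\mathbb R$, and consider on $\mathcal M^N$ the system $$\dot y_k = 2\alpha\,\mathrm{Proj}_{T_{y_k}\mathcal M}\Big(\sum_{j=1}^N a_{jk}(y_j-y_k)\Big),\qquad k=1,\dots,N, \qquad (*)$$ where $\mathrm{Proj}_{T_{y_k}\mathcal M}$ is the orthogonal projection of $\mathbb R^m$ onto the tangent space of $\mathcal M$ at $y_k$. An equilibrium is a point of $\mathcal M^N$ at which all the right-hand sides vanish. A configuration $y\in\mathcal M^N$ is a consensus (respectively anti-consensus) configuration for $G$ if, for every $k$, $y_k$ maximizes (respectively minimizes) $c\mapsto c^T\sum_j a_{jk}y_j$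 over $c\in\mathcal M$; it is synchronized if $y_j=y_k$ for all $j,k$. A set $S\subseteq\mathcal M^N$ is asymptotically stable if solutions starting sufficiently close to $S$ stay arbitrarily close to $S$ for all $t\ge0$ and all solutions starting in some neighbourhood of $S$ converge to $S$ as $t\to\infty$. Since equilibria of $(*)$ are never isolated when $\dim\mathcal M>0$ and $N\ge1$ (by symmetry), an equilibrium is called asymptotically stable if it belongs to a compact set $S$ of equilibria that is asymptotically stable and rectifiably connected (any two points of $S$ are joined by a curve of finite length in $S$); the case where $S$ is a single point is the classical notion. Then: 1. For every initial configuration in $\mathcal M^N$, $(*)$ has a solution in $\mathcal M^N$ defined for all $t\ge0$, and every such solution converges, as $t\to\infty$, to the set of equilibria. 2. If $\alpha<0$, every asymptotically stable equilibrium is an anti-consensus configuration for $G$. 3. If $\alpha>0$, every asymptotically stable equilibrium is a consensus configuration for $G$. 4. If $\alpha>0$ and $G$ is the equally-weighted complete graph ($a_{jk}=w>0$ for all $j\ne k$), the asymptotically stable equilibria are exactly the synchronized configurations in $\mathcal M^N$. -/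

import Mathlib

open Set Filter Topology
open scoped ContDiff

noncomputable section

namespace ManifoldConsensus

/-- The ambient Euclidean space `ℝ^m`. -/
abbrev Amb (m : ℕ) : Type := EuclideanSpace ℝ (Fin m)

/-- `M ⊆ ℝ^m` is a smoothly embedded submanifold of dimension `d` (without boundary): around each
of its points there is a smooth chart of `ℝ^m` in which `M` is a `d`-dimensional linear slice. -/
def IsSmoothSubmanifold {m : ℕ} (d : ℕ) (M : Set (Amb m)) : Prop :=
  ∀ x ∈ M, ∃ φ : OpenPartialHomeomorph (Amb m) (Amb m), ∃ V : Submodule ℝ (Amb m),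
    x ∈ φ.source ∧ ContDiffOn ℝ ∞ φ φ.source ∧ ContDiffOn ℝ ∞ φ.symm φ.target ∧
    Module.finrank ℝ V = d ∧ ∀ z ∈ φ.source, z ∈ M ↔ φ z ∈ V

/-- The tangent space to `M` at `x`: velocities at time `0` of curves in `M` passing through `x`.
(The span changes nothing for a submanifold.) -/
def tangentSpaceAt {m : ℕ} (M : Set (Amb m)) (x : Amb m) : Submodule ℝ (Amb m) :=
  Submodule.span ℝ {v | ∃ γ : ℝ → Amb m, γ 0 = x ∧ (∀ᶠ t in 𝓝 (0 : ℝ), γ t ∈ M) ∧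
    HasDerivAt γ v 0}

/-- `M` is a connected compact manifold smoothly embedded in `ℝ^m`, of constant Euclidean norm,
and homogeneous under a group of orthogonal transformations of `ℝ^m` that preserve `M`. -/
structure IsHomogeneousEmbedded {m : ℕ} (M : Set (Amb m)) : Prop where
  compact : IsCompact M
  connected : IsConnected M
  submanifold : ∃ d : ℕ, IsSmoothSubmanifold d M
  norm_const : ∃ r : ℝ, ∀ x ∈ M, ‖x‖ = r
  homogeneous : ∃ G : Subgroup (Amb m ≃ₗᵢ[ℝ] Amb m),
    (∀ g ∈ G, g '' M = M) ∧ ∀ x ∈ M, ∀ y ∈ M, ∃ g ∈ G, g x = y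

/-- All local maxima over `M` of any linear function `c ↦ cᵀ b` are global maxima. -/
def LinearLocalMaxAreGlobal {m : ℕ} (M : Set (Amb m)) : Prop :=
  ∀ b : Amb m, ∀ c ∈ M, IsLocalMaxOn (fun z => inner ℝ z b) M c →
    IsMaxOn (fun z => inner ℝ z b) M c

/-- `A = [a_jk]` is the adjacency matrix of a weighted undirected graph: symmetric, with
nonnegative entries (`a_jk > 0` on edges, `a_jk = 0` off edges) and no self-loops. -/
structure IsUndirectedAdjacency {N : ℕ} (A : Matrix (Fin N) (Fin N) ℝ) : Prop where
  symm : A.IsSymm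
  nonneg : ∀ j k, 0 ≤ A j k
  no_loops : ∀ k, A k k = 0

/-- The equally-weighted complete graph. -/
def IsEquallyWeightedComplete {N : ℕ} (A : Matrix (Fin N) (Fin N) ℝ) : Prop :=
  ∃ w : ℝ, 0 < w ∧ ∀ j k, A j k = if j = k then 0 else w

/-- The configurations of `N` agents on `M`. -/
def configurations {m : ℕ} (N : ℕ) (M : Set (Amb m)) : Set (Fin N → Amb m) :=
  {y | ∀ k, y k ∈ M}

/-- Synchronization: all agents at the same point. -/
def IsSynchronized {m N : ℕ} (y : Fin N → Amb m) : Prop := ∀ j k, y j = y k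

/-- Consensus: every `y_k` maximizes `c ↦ cᵀ ∑_j a_jk y_j` over `M`. -/
def IsConsensus {m N : ℕ} (M : Set (Amb m)) (A : Matrix (Fin N) (Fin N) ℝ)
    (y : Fin N → Amb m) : Prop :=
  y ∈ configurations N M ∧ ∀ k, IsMaxOn (fun c => inner ℝ c (∑ j, A j k • y j)) M (y k)

/-- Anti-consensus: every `y_k` minimizes `c ↦ cᵀ ∑_j a_jk y_j` over `M`. -/
def IsAntiConsensus {m N : ℕ} (M : Set (Amb m)) (A : Matrix (Fin N) (Fin N) ℝ)
    (y : Fin N → Amb m) : Prop :=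
  y ∈ configurations N M ∧ ∀ k, IsMinOn (fun c => inner ℝ c (∑ j, A j k • y j)) M (y k)

/-- The right-hand side for agent `k` of the gradient algorithm:
`2 α Proj_{T_{y_k} M} (∑_j a_jk (y_j - y_k))`, with the orthogonal projection. -/
def gradientField {m N : ℕ} (M : Set (Amb m)) (A : Matrix (Fin N) (Fin N) ℝ) (α : ℝ)
    (y : Fin N → Amb m) (k : Fin N) : Amb m :=
  (2 * α) • (tangentSpaceAt M (y k)).starProjection (∑ j, A j k • (y j - y k))

/-- `y` is a solution on `[0, ∞)` of the gradient algorithm: it stays in `M^N` and satisfies the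
differential equation at every `t ≥ 0` (one-sided derivative at `t = 0`). -/
def IsSolution {m N : ℕ} (M : Set (Amb m)) (A : Matrix (Fin N) (Fin N) ℝ) (α : ℝ)
    (y : ℝ → Fin N → Amb m) : Prop :=
  ∀ t, 0 ≤ t → y t ∈ configurations N M ∧
    ∀ k, HasDerivWithinAt (fun s => y s k) (gradientField M A α (y t) k) (Ici 0) t

/-- The set of equilibria of the gradient algorithm in `M^N`. -/
def equilibria {m N : ℕ} (M : Set (Amb m)) (A : Matrix (Fin N) (Fin N) ℝ) (α : ℝ) :
    Set (Fin N → Amb m) :=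
  {y | y ∈ configurations N M ∧ ∀ k, gradientField M A α y k = 0}

/-- Asymptotic stability of a set `S ⊆ M^N` in the sense of Lyapunov: solutions starting close
enough to `S` stay close to `S`, and solutions starting close enough to `S` converge to `S`. -/
def IsAsymptoticallyStableSet {m N : ℕ} (M : Set (Amb m)) (A : Matrix (Fin N) (Fin N) ℝ) (α : ℝ)
    (S : Set (Fin N → Amb m)) : Prop :=
  (∀ U ∈ 𝓝ˢ S, ∃ V ∈ 𝓝ˢ S, ∀ y, IsSolution M A α y → y 0 ∈ V → ∀ t, 0 ≤ t → y t ∈ U) ∧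
  ∃ V ∈ 𝓝ˢ S, ∀ y, IsSolution M A α y → y 0 ∈ V → Tendsto y atTop (𝓝ˢ S)

/-- Any two points of `S` are joined inside `S` by a curve of finite length
(parametrized in a Lipschitz way). -/
def IsRectifiablyConnected {X : Type*} [PseudoMetricSpace X] (S : Set X) : Prop :=
  ∀ x ∈ S, ∀ y ∈ S, ∃ γ : ℝ → X, (∃ K, LipschitzOnWith K γ (Icc 0 1)) ∧
    γ 0 = x ∧ γ 1 = y ∧ ∀ t ∈ Icc (0 : ℝ) 1, γ t ∈ S

/-- Asymptotically stable equilibria. Equilibria are never isolated when `M` has positive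
dimension, because the orthogonal transformations acting on `M` carry equilibria to equilibria;
so stability is that of the continuum of equilibria `S` to which `y` belongs.
With `S = {y}` this is the classical notion for an isolated equilibrium. -/
def IsAsymptoticallyStableEquilibrium {m N : ℕ} (M : Set (Amb m))
    (A : Matrix (Fin N) (Fin N) ℝ) (α : ℝ) (y : Fin N → Amb m) : Prop :=
  ∃ S : Set (Fin N → Amb m), y ∈ S ∧ S ⊆ equilibria M A α ∧ IsCompact S ∧
    IsRectifiablyConnected S ∧ IsAsymptoticallyStableSet M A α S

end ManifoldConsensus

end

open ManifoldConsensus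

/-!
The field is, up to the factor `2α`, the orthogonal projection to the tangent spaces of the vectors
`b_k = ∑ j, a_jk y_j`: the terms in `y_k` drop out because the norm is constant on `M`. As the graph
is undirected, `b_k` is the gradient in `y_k` of `U = ½ ∑ j k, a_jk ⟪y_j, y_k⟫` (`potential`), so
along solutions `α U` increases at half the squared speed at least
(`IsSolution.mul_potential_growth`).

*Existence.* In a slice chart the tangent projection is Lipschitz near a point, and homogeneity
makes this uniform on `M`. A Lipschitz field on a compact set, tangent to it, has global
solutions there (`exists_solution_of_tangent`): extend the field to a bounded Lipschitz field on the
whole space, solve there by Picard-Lindelöf, and use Grönwall's inequality for the distance to the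
set to see that the set is invariant. No global tubular neighbourhood is needed.

*Convergence* to the equilibria follows since `α U` is bounded and monotone and the speed is
uniformly continuous in time (`IsSolution.tendsto_equilibria`).

*Stability.* Equilibria are critical points of `U` on `M^N`, so `U` is constant along Lipschitz
curves of equilibria. Points near an asymptotically stable connected set of equilibria flow to it
while `α U` increases, so `α U` has a local maximum at each of its points. There are no loops, so `U`
is affine in each `y_k`, and `y_k` is a local, hence a global, maximum over `M` of
`c ↦ α ⟪c, b_k⟫` (`isMaxOn_of_isAsymptoticallyStableEquilibrium`).

*Complete graph.* Adding two maximality conditions shows that consensus configurations are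
synchronized (`IsConsensus.isSynchronized`). Conversely the synchronized configurations are a
copy of `M`, on which `∑ j k, a_jk ‖y_j - y_k‖²` vanishes; this is a Lyapunov function, and nearby
equilibria are synchronized since displacements within `M` are tangent to first order, uniformly
over `M` (`exists_isSynchronized_of_equilibrium`).
-/

namespace ManifoldConsensus

/-! ### Tangent spaces in a slice chart -/

section Chart

variable {m : ℕ} {M : Set (Amb m)} {φ : OpenPartialHomeomorph (Amb m) (Amb m)}
  {V : Submodule ℝ (Amb m)} {x : Amb m}

theorem hasFDerivAt_chart (hφ : ContDiffOn ℝ ∞ φ φ.source) (hx : x ∈ φ.source) :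
    HasFDerivAt φ (fderiv ℝ φ x) x :=
  ((hφ.contDiffAt (φ.open_source.mem_nhds hx)).differentiableAt (by simp)).hasFDerivAt

theorem hasFDerivAt_chart_symm (hψ : ContDiffOn ℝ ∞ φ.symm φ.target) (hx : x ∈ φ.source) :
    HasFDerivAt φ.symm (fderiv ℝ φ.symm (φ x)) (φ x) :=
  ((hψ.contDiffAt (φ.open_target.mem_nhds (φ.map_source hx))).differentiableAt
    (by simp)).hasFDerivAt

theorem fderiv_symm_fderiv_chart (hφ : ContDiffOn ℝ ∞ φ φ.source)
    (hψ : ContDiffOn ℝ ∞ φ.symm φ.target) (hx : x ∈ φ.source) (v : Amb m) :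
    fderiv ℝ φ.symm (φ x) (fderiv ℝ φ x v) = v := by
  have h := (hasFDerivAt_chart_symm hψ hx).comp x (hasFDerivAt_chart hφ hx)
  have h' : HasFDerivAt (φ.symm ∘ φ) (ContinuousLinearMap.id ℝ (Amb m)) x :=
    (hasFDerivAt_id x).congr_of_eventuallyEq (φ.eventually_left_inverse hx)
  exact DFunLike.congr_fun (h.unique h') v

theorem fderiv_fderiv_symm_chart (hφ : ContDiffOn ℝ ∞ φ φ.source)
    (hψ : ContDiffOn ℝ ∞ φ.symm φ.target) (hx : x ∈ φ.source) (v : Amb m) :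
    fderiv ℝ φ x (fderiv ℝ φ.symm (φ x) v) = v := by
  have h1 : HasFDerivAt φ (fderiv ℝ φ x) (φ.symm (φ x)) := by
    rw [φ.left_inv hx]; exact hasFDerivAt_chart hφ hx
  have h := h1.comp (φ x) (hasFDerivAt_chart_symm hψ hx)
  have h' : HasFDerivAt (φ ∘ φ.symm) (ContinuousLinearMap.id ℝ (Amb m)) (φ x) :=
    (hasFDerivAt_id _).congr_of_eventuallyEq (φ.eventually_right_inverse (φ.map_source hx))
  exact DFunLike.congr_fun (h.unique h') v

/-- In a slice chart `φ`, the straight line through `φ x` with direction `w ∈ V` is carried by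
`φ⁻¹` to a curve in `M`. -/
theorem exists_curve_of_mem_slice (hψ : ContDiffOn ℝ ∞ φ.symm φ.target)
    (hV : ∀ z ∈ φ.source, z ∈ M ↔ φ z ∈ V) (hx : x ∈ φ.source) (hxM : x ∈ M) {w : Amb m}
    (hw : w ∈ V) :
    ∃ γ : ℝ → Amb m, γ 0 = x ∧ (∀ᶠ t in 𝓝 (0 : ℝ), γ t ∈ M) ∧
      HasDerivAt γ (fderiv ℝ φ.symm (φ x) w) 0 := by
  have hline : HasDerivAt (fun t : ℝ => φ x + t • w) w 0 := by
    simpa using ((hasDerivAt_id (0 : ℝ)).smul_const w).const_add (φ x)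
  refine ⟨fun t => φ.symm (φ x + t • w), by simp [φ.left_inv hx], ?_, ?_⟩
  · have hmem : ∀ᶠ t in 𝓝 (0 : ℝ), φ x + t • w ∈ φ.target := by
      refine hline.continuousAt.eventually_mem (φ.open_target.mem_nhds ?_)
      simpa using φ.map_source hx
    filter_upwards [hmem] with t ht
    rw [hV _ (φ.map_target ht), φ.right_inv ht]
    exact V.add_mem ((hV x hx).1 hxM) (V.smul_mem t hw)
  · have h1 : HasFDerivAt φ.symm (fderiv ℝ φ.symm (φ x)) (φ x + (0 : ℝ) • w) := by
      simpa using hasFDerivAt_chart_symm hψ hx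
    exact h1.comp_hasDerivAt (0 : ℝ) hline

theorem tangentSpaceAt_eq_map_chart (hφ : ContDiffOn ℝ ∞ φ φ.source)
    (hψ : ContDiffOn ℝ ∞ φ.symm φ.target) (hV : ∀ z ∈ φ.source, z ∈ M ↔ φ z ∈ V)
    (hx : x ∈ φ.source) (hxM : x ∈ M) :
    tangentSpaceAt M x = V.map (fderiv ℝ φ.symm (φ x) : Amb m →ₗ[ℝ] Amb m) := by
  refine le_antisymm (Submodule.span_le.2 ?_) ?_
  · rintro v ⟨γ, h0, hγ, hd⟩
    refine ⟨fderiv ℝ φ x v, ?_, fderiv_symm_fderiv_chart hφ hψ hx v⟩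
    have h1 : HasFDerivAt φ (fderiv ℝ φ x) (γ 0) := by rw [h0]; exact hasFDerivAt_chart hφ hx
    have h2 : HasDerivAt (φ ∘ γ) (fderiv ℝ φ x v) 0 := h1.comp_hasDerivAt (0 : ℝ) hd
    have hslope := h2.tendsto_slope_zero
    have hclosed : IsClosed (V : Set (Amb m)) := V.closed_of_finiteDimensional
    refine hclosed.mem_of_tendsto hslope ?_
    have hsrc : ∀ᶠ t in 𝓝 (0 : ℝ), γ t ∈ φ.source :=
      hd.continuousAt.eventually_mem (φ.open_source.mem_nhds (by rwa [h0]))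
    filter_upwards [nhdsWithin_le_nhds (hγ.and hsrc)] with t ht
    refine V.smul_mem _ (V.sub_mem ?_ ?_)
    · simpa using (hV _ ht.2).1 ht.1
    · simpa [h0] using (hV x hx).1 hxM
  · rintro _ ⟨w, hw, rfl⟩
    exact Submodule.subset_span (exists_curve_of_mem_slice hψ hV hx hxM hw)

end Chart

section Submanifold

variable {m d : ℕ} {M : Set (Amb m)} {x : Amb m}

theorem IsSmoothSubmanifold.exists_curve (hM : IsSmoothSubmanifold d M) (hx : x ∈ M) {v : Amb m}
    (hv : v ∈ tangentSpaceAt M x) :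
    ∃ γ : ℝ → Amb m, γ 0 = x ∧ (∀ᶠ t in 𝓝 (0 : ℝ), γ t ∈ M) ∧ HasDerivAt γ v 0 := by
  obtain ⟨φ, V, hxs, hφ, hψ, -, hV⟩ := hM x hx
  rw [tangentSpaceAt_eq_map_chart hφ hψ hV hxs hx] at hv
  obtain ⟨w, hw, rfl⟩ := hv
  exact exists_curve_of_mem_slice hψ hV hxs hx hw

theorem norm_sub_starProjection_le (K : Submodule ℝ (Amb m)) (u : Amb m) {t : Amb m}
    (ht : t ∈ K) : ‖u - K.starProjection u‖ ≤ ‖u - t‖ := by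
  have h : u - K.starProjection u = Kᗮ.starProjection (u - t) := by
    rw [Submodule.starProjection_orthogonal]
    simp [Submodule.starProjection_eq_self_iff.2 ht]
  rw [h]
  exact Submodule.norm_starProjection_apply_le _ _

/-- Displacements within a submanifold are tangent to first order. -/
theorem IsSmoothSubmanifold.sub_starProjection_le (hM : IsSmoothSubmanifold d M) (hx : x ∈ M)
    {ε : ℝ} (hε : 0 < ε) :
    ∃ δ > 0, ∀ z ∈ M, ‖z - x‖ < δ →
      ‖(z - x) - (tangentSpaceAt M x).starProjection (z - x)‖ ≤ ε * ‖z - x‖ := by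
  obtain ⟨φ, V, hxs, hφ, hψ, -, hV⟩ := hM x hx
  have h1 := (hasFDerivAt_chart hφ hxs).isLittleO
  have h2 := ((fderiv ℝ φ.symm (φ x)).isBigO_comp
    (fun z => φ z - φ x - fderiv ℝ φ x (z - x)) (𝓝 x)).trans_isLittleO h1
  have h3 := (h2.bound hε).and (φ.open_source.mem_nhds hxs)
  obtain ⟨δ, hδ, h⟩ := Metric.eventually_nhds_iff.1 h3
  refine ⟨δ, hδ, fun z hz hzx => ?_⟩
  obtain ⟨hb, hzs⟩ := h (by rwa [dist_eq_norm])
  have ht : fderiv ℝ φ.symm (φ x) (φ z - φ x) ∈ tangentSpaceAt M x := by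
    rw [tangentSpaceAt_eq_map_chart hφ hψ hV hxs hx]
    exact ⟨_, V.sub_mem ((hV z hzs).1 hz) ((hV x hxs).1 hx), rfl⟩
  refine (norm_sub_starProjection_le _ _ ht).trans ?_
  rw [map_sub, fderiv_symm_fderiv_chart hφ hψ hxs] at hb
  rwa [norm_sub_rev]

/-- Two orthogonal projections are close if each is close to the identity on the range of the
other. -/
theorem norm_starProjection_sub_le (K L : Submodule ℝ (Amb m)) {c : ℝ} (hc : 0 ≤ c)
    (hKL : ∀ w ∈ K, ‖w - L.starProjection w‖ ≤ c * ‖w‖)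
    (hLK : ∀ w ∈ L, ‖w - K.starProjection w‖ ≤ c * ‖w‖) :
    ‖K.starProjection - L.starProjection‖ ≤ 2 * c := by
  have key : ∀ K L : Submodule ℝ (Amb m), (∀ w ∈ K, ‖w - L.starProjection w‖ ≤ c * ‖w‖) →
      ‖(1 - L.starProjection) * K.starProjection‖ ≤ c := by
    intro K L h
    refine ContinuousLinearMap.opNorm_le_bound _ hc fun u => ?_
    refine (h _ (K.starProjection_apply_mem u)).trans ?_
    gcongr
    exact Submodule.norm_starProjection_apply_le _ _
  have h2 : ‖L.starProjection * (1 - K.starProjection)‖ ≤ c := by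
    have : star (L.starProjection * (1 - K.starProjection)) =
        (1 - K.starProjection) * L.starProjection := by
      rw [star_mul, star_sub, star_one, (isSelfAdjoint_starProjection L).star_eq,
        (isSelfAdjoint_starProjection K).star_eq]
    rw [← norm_star, this]
    exact key L K hLK
  have : K.starProjection - L.starProjection =
      (1 - L.starProjection) * K.starProjection - L.starProjection * (1 - K.starProjection) := by
    noncomm_ring
  rw [this]
  linarith [norm_sub_le ((1 - L.starProjection) * K.starProjection)
    (L.starProjection * (1 - K.starProjection)), key K L hKL]

/-- The tangent projection of a submanifold is Lipschitz at each point. -/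
theorem IsSmoothSubmanifold.norm_starProjection_sub_le (hM : IsSmoothSubmanifold d M)
    (hx : x ∈ M) :
    ∃ C, 0 ≤ C ∧ ∃ δ > 0, ∀ y ∈ M, ‖y - x‖ < δ →
      ‖(tangentSpaceAt M y).starProjection - (tangentSpaceAt M x).starProjection‖ ≤
        C * ‖y - x‖ := by
  obtain ⟨φ, V, hxs, hφ, hψ, -, hV⟩ := hM x hx
  set A : Amb m → (Amb m →L[ℝ] Amb m) := fun y => fderiv ℝ φ.symm (φ y) with hA
  have hφx : ContDiffAt ℝ ∞ φ x := hφ.contDiffAt (φ.open_source.mem_nhds hxs)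
  have hψx : ContDiffAt ℝ ∞ φ.symm (φ x) :=
    hψ.contDiffAt (φ.open_target.mem_nhds (φ.map_source hxs))
  have hA1 : ContDiffAt ℝ 1 A x :=
    (hψx.fderiv_right (m := 1) (by norm_cast)).comp x (hφx.of_le (by norm_cast))
  obtain ⟨K, s, hs, hK⟩ := hA1.exists_lipschitzOnWith
  have hB : ContinuousAt (fun y => ‖fderiv ℝ φ y‖) x :=
    (hφx.fderiv_right (m := 0) (by simp)).continuousAt.norm
  set b := ‖fderiv ℝ φ x‖ + 1
  have hBb : ∀ᶠ y in 𝓝 x, ‖fderiv ℝ φ y‖ < b := hB.eventually_lt_const (by simp [b])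
  obtain ⟨δ, hδ, h⟩ := Metric.eventually_nhds_iff.1
    ((hBb.and (φ.open_source.mem_nhds hxs)).and hs)
  have hb : 0 ≤ b := by positivity
  -- `A z' (A z)⁻¹` carries the tangent space at `z` to the one at `z'`.
  have key : ∀ z ∈ M, ∀ z' ∈ M, z ∈ φ.source → z' ∈ φ.source → ‖fderiv ℝ φ z‖ < b →
      ∀ w ∈ tangentSpaceAt M z, ‖w - (tangentSpaceAt M z').starProjection w‖ ≤
        ‖A z - A z'‖ * b * ‖w‖ := by
    intro z hz z' hz' hzs hzs' hzb w hw
    rw [tangentSpaceAt_eq_map_chart hφ hψ hV hzs hz] at hw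
    obtain ⟨v, hv, rfl⟩ := hw
    have hmem : A z' v ∈ tangentSpaceAt M z' := by
      rw [tangentSpaceAt_eq_map_chart hφ hψ hV hzs' hz']
      exact ⟨v, hv, rfl⟩
    refine (norm_sub_starProjection_le _ _ hmem).trans ?_
    have hvb : ‖v‖ ≤ b * ‖A z v‖ := by
      conv_lhs => rw [← fderiv_fderiv_symm_chart hφ hψ hzs v]
      exact (ContinuousLinearMap.le_opNorm _ _).trans (by gcongr)
    calc ‖A z v - A z' v‖ = ‖(A z - A z') v‖ := by simp
      _ ≤ ‖A z - A z'‖ * ‖v‖ := ContinuousLinearMap.le_opNorm _ _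
      _ ≤ ‖A z - A z'‖ * (b * ‖A z v‖) := by gcongr
      _ = _ := by rw [mul_assoc]; rfl
  refine ⟨2 * (K * b), by positivity, δ, hδ, fun y hy hyx => ?_⟩
  obtain ⟨⟨hyb, hys⟩, hyS⟩ := h (y := y) (by rwa [dist_eq_norm])
  obtain ⟨⟨hxb, -⟩, hxS⟩ := h (y := x) (by simpa)
  have hKA : ‖A y - A x‖ ≤ K * ‖y - x‖ := by
    simpa [dist_eq_norm] using hK.dist_le_mul y hyS x hxS
  have hc : ‖A y - A x‖ * b ≤ K * ‖y - x‖ * b := by gcongr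
  refine (ManifoldConsensus.norm_starProjection_sub_le _ _ (c := K * ‖y - x‖ * b)
    (by positivity) (fun w hw => ?_) (fun w hw => ?_)).trans (le_of_eq (by ring))
  · exact (key y hy x hx hys hxs hyb w hw).trans (by gcongr)
  · refine (key x hx y hy hxs hys hxb w hw).trans ?_
    rw [norm_sub_rev (A x)]
    gcongr

end Submanifold

/-! ### Uniform estimates by homogeneity -/

section Homogeneous

variable {m : ℕ} {M : Set (Amb m)}

theorem IsHomogeneousEmbedded.inner_eq_zero (hM : IsHomogeneousEmbedded M) {x v : Amb m}
    (hv : v ∈ tangentSpaceAt M x) : inner ℝ x v = 0 := by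
  obtain ⟨r, hr⟩ := hM.norm_const
  refine Submodule.span_induction (p := fun v _ => inner ℝ x v = 0) ?_ (by simp)
    (fun v w _ _ hv hw => by rw [inner_add_right, hv, hw, add_zero])
    (fun a v _ hv => by rw [inner_smul_right, hv, mul_zero]) hv
  rintro v ⟨γ, h0, hγ, hd⟩
  have h1 := hd.norm_sq
  have h2 : HasDerivAt (fun t => ‖γ t‖ ^ 2) 0 0 :=
    (hasDerivAt_const (0 : ℝ) (r ^ 2)).congr_of_eventuallyEq
      (hγ.mono fun t ht => by simp [hr _ ht])
  have h3 := h1.unique h2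
  rw [h0] at h3
  linarith

theorem tangentSpaceAt_map (g : Amb m ≃ₗᵢ[ℝ] Amb m) (hg : g '' M = M) (x : Amb m) :
    tangentSpaceAt M (g x) =
      (tangentSpaceAt M x).map (g.toLinearEquiv : Amb m →ₗ[ℝ] Amb m) := by
  rw [tangentSpaceAt, tangentSpaceAt, Submodule.map_span]
  congr 1
  have hmem : ∀ z, z ∈ M → g z ∈ M := fun z hz => hg ▸ mem_image_of_mem g hz
  have hmem' : ∀ z, z ∈ M → g.symm z ∈ M := by
    intro z hz
    rw [← hg] at hz
    obtain ⟨u, hu, rfl⟩ := hz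
    simpa using hu
  ext v
  constructor
  · rintro ⟨γ, h0, hγ, hd⟩
    refine ⟨g.symm v, ⟨fun t => g.symm (γ t), by simp [h0], hγ.mono fun t ht => hmem' _ ht, ?_⟩,
      by simp⟩
    exact (g.symm.toContinuousLinearEquiv.hasFDerivAt (x := γ 0)).comp_hasDerivAt (0 : ℝ) hd
  · rintro ⟨w, ⟨γ, h0, hγ, hd⟩, rfl⟩
    refine ⟨fun t => g (γ t), by simp [h0], hγ.mono fun t ht => hmem _ ht, ?_⟩
    exact (g.toContinuousLinearEquiv.hasFDerivAt (x := γ 0)).comp_hasDerivAt (0 : ℝ) hd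

theorem starProjection_tangentSpaceAt_map (g : Amb m ≃ₗᵢ[ℝ] Amb m) (hg : g '' M = M)
    (x u : Amb m) :
    (tangentSpaceAt M (g x)).starProjection (g u) =
      g ((tangentSpaceAt M x).starProjection u) := by
  have h := Submodule.starProjection_map_apply g (tangentSpaceAt M x) (g u)
  rw [g.symm_apply_apply] at h
  rw [← h]
  congr 2
  exact tangentSpaceAt_map g hg x

/-- Displacements within `M` are tangent to first order, uniformly over the base point. -/
theorem IsHomogeneousEmbedded.sub_starProjection_le (hM : IsHomogeneousEmbedded M) {ε : ℝ}
    (hε : 0 < ε) :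
    ∃ δ > 0, ∀ x ∈ M, ∀ z ∈ M, ‖z - x‖ < δ →
      ‖(z - x) - (tangentSpaceAt M x).starProjection (z - x)‖ ≤ ε * ‖z - x‖ := by
  obtain ⟨d, hd⟩ := hM.submanifold
  obtain ⟨G, hGM, hG⟩ := hM.homogeneous
  obtain ⟨p, hp⟩ := hM.connected.nonempty
  obtain ⟨δ, hδ, h⟩ := hd.sub_starProjection_le hp hε
  refine ⟨δ, hδ, fun x hx z hz hzx => ?_⟩
  obtain ⟨g, hgG, rfl⟩ := hG x hx p hp
  have h1 := h (g z) (hGM g hgG ▸ mem_image_of_mem g hz)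
  rw [← map_sub, starProjection_tangentSpaceAt_map g (hGM g hgG), ← map_sub,
    LinearIsometryEquiv.norm_map, LinearIsometryEquiv.norm_map] at h1
  exact h1 hzx

/-- The tangent projection is Lipschitz on `M`. -/
theorem IsHomogeneousEmbedded.starProjection_sub_le (hM : IsHomogeneousEmbedded M) :
    ∃ C, 0 ≤ C ∧ ∀ x ∈ M, ∀ y ∈ M, ∀ u,
      ‖(tangentSpaceAt M y).starProjection u - (tangentSpaceAt M x).starProjection u‖ ≤
        C * ‖y - x‖ * ‖u‖ := by
  obtain ⟨d, hd⟩ := hM.submanifold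
  obtain ⟨G, hGM, hG⟩ := hM.homogeneous
  obtain ⟨p, hp⟩ := hM.connected.nonempty
  obtain ⟨C, hC, δ, hδ, h⟩ := hd.norm_starProjection_sub_le hp
  refine ⟨max C (2 / δ), le_max_of_le_left hC, fun x hx y hy u => ?_⟩
  rcases lt_or_ge ‖y - x‖ δ with hyx | hyx
  · obtain ⟨g, hgG, rfl⟩ := hG x hx p hp
    have h1 := h (g y) (hGM g hgG ▸ mem_image_of_mem g hy)
      (by rwa [← map_sub, LinearIsometryEquiv.norm_map])
    rw [← map_sub, LinearIsometryEquiv.norm_map] at h1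
    have h2 := ContinuousLinearMap.le_of_opNorm_le _ h1 (g u)
    rw [sub_apply, starProjection_tangentSpaceAt_map g (hGM g hgG),
      starProjection_tangentSpaceAt_map g (hGM g hgG), ← map_sub,
      LinearIsometryEquiv.norm_map, LinearIsometryEquiv.norm_map] at h2
    exact h2.trans (by gcongr; exact le_max_left _ _)
  · have h2 : 2 ≤ max C (2 / δ) * ‖y - x‖ := by
      calc (2 : ℝ) = 2 / δ * δ := by field_simp
        _ ≤ _ := by gcongr; exact le_max_right _ _
    -- The operator norms of the projections are at most one.
    calc _ ≤ ‖(tangentSpaceAt M y).starProjection u‖ + ‖(tangentSpaceAt M x).starProjection u‖ :=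
          norm_sub_le _ _
      _ ≤ ‖u‖ + ‖u‖ := add_le_add (Submodule.norm_starProjection_apply_le _ _)
          (Submodule.norm_starProjection_apply_le _ _)
      _ = 2 * ‖u‖ := by ring
      _ ≤ _ := by gcongr

end Homogeneous

/-! ### Connection by Lipschitz curves -/

section LipschitzJoined

/-- Two points joined inside `S` by a Lipschitz curve parametrized by `[0, 1]`. -/
def LipschitzJoined {X : Type*} [PseudoMetricSpace X] (S : Set X) (x y : X) : Prop :=
  ∃ γ : ℝ → X, (∃ K, LipschitzOnWith K γ (Icc 0 1)) ∧ γ 0 = x ∧ γ 1 = y ∧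
    ∀ t ∈ Icc (0 : ℝ) 1, γ t ∈ S

theorem LipschitzJoined.symm {X : Type*} [PseudoMetricSpace X] {S : Set X} {x y : X}
    (h : LipschitzJoined S x y) : LipschitzJoined S y x := by
  obtain ⟨γ, ⟨K, hK⟩, h0, h1, hS⟩ := h
  have hmaps : MapsTo (fun t : ℝ => 1 - t) (Icc 0 1) (Icc 0 1) :=
    fun t ht => ⟨by linarith [ht.2], by linarith [ht.1]⟩
  refine ⟨fun t => γ (1 - t), ⟨K * 1, hK.comp (g := γ) ?_ hmaps⟩, by simpa, by simpa,
    fun t ht => hS _ (hmaps ht)⟩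
  exact LipschitzOnWith.of_dist_le_mul fun s _ t _ => by rw [dist_sub_left]; simp

/-- In a normed space a concatenation of `γ₁` and `γ₂` is
`t ↦ γ₁ (min (2t) 1) + γ₂ (max (2t - 1) 0) - γ₂ 0`, visibly Lipschitz. -/
theorem LipschitzJoined.trans {E : Type*} [NormedAddCommGroup E] {S : Set E} {x y z : E}
    (h₁ : LipschitzJoined S x y) (h₂ : LipschitzJoined S y z) : LipschitzJoined S x z := by
  obtain ⟨γ₁, ⟨K₁, hK₁⟩, h₁0, h₁1, hS₁⟩ := h₁
  obtain ⟨γ₂, ⟨K₂, hK₂⟩, h₂0, h₂1, hS₂⟩ := h₂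
  have hm₁ : MapsTo (fun t : ℝ => min (2 * t) 1) (Icc 0 1) (Icc 0 1) :=
    fun t ht => ⟨le_min (by linarith [ht.1]) zero_le_one, min_le_right _ _⟩
  have hm₂ : MapsTo (fun t : ℝ => max (2 * t - 1) 0) (Icc 0 1) (Icc 0 1) :=
    fun t ht => ⟨le_max_right _ _, max_le (by linarith [ht.2]) zero_le_one⟩
  have hL : LipschitzWith 2 (fun t : ℝ => 2 * t) :=
    LipschitzWith.of_dist_le_mul fun s t => by
      simp [Real.dist_eq, ← mul_sub, abs_mul]
  have hL₂ : LipschitzWith 2 (fun t : ℝ => 2 * t - 1) :=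
    LipschitzWith.of_dist_le_mul fun s t => by
      simp [Real.dist_eq, ← mul_sub, abs_mul]
  have hl₁ := hK₁.comp ((hL.min_const 1).lipschitzOnWith (s := Icc 0 1)) hm₁
  have hl₂ := hK₂.comp ((hL₂.max_const 0).lipschitzOnWith (s := Icc 0 1)) hm₂
  refine ⟨fun t => γ₁ (min (2 * t) 1) + γ₂ (max (2 * t - 1) 0) - y,
    ⟨K₁ * 2 + K₂ * 2, LipschitzOnWith.of_dist_le_mul fun s hs t ht => ?_⟩, ?_, ?_, ?_⟩
  · rw [dist_sub_right]
    refine (dist_add_add_le _ _ _ _).trans ?_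
    rw [NNReal.coe_add, add_mul]
    exact add_le_add (hl₁.dist_le_mul s hs t ht) (hl₂.dist_le_mul s hs t ht)
  · simp [h₁0, h₂0]
  · norm_num [h₁1, h₂1]
  · intro t ht
    dsimp only
    rcases le_total (2 * t) 1 with h | h
    · rw [max_eq_right (by linarith), h₂0, add_sub_cancel_right]
      exact hS₁ _ (hm₁ ht)
    · rw [min_eq_right h, h₁1, add_sub_cancel_left]
      exact hS₂ _ (hm₂ ht)

/-- Nearby points of a submanifold are joined by the image of a segment of a slice chart. -/
theorem IsSmoothSubmanifold.eventually_lipschitzJoined {m d : ℕ} {M : Set (Amb m)} {x : Amb m}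
    (hM : IsSmoothSubmanifold d M) (hx : x ∈ M) : ∀ᶠ z in 𝓝[M] x, LipschitzJoined M x z := by
  obtain ⟨φ, V, hxs, hφ, hψ, -, hV⟩ := hM x hx
  have hxt := φ.map_source hxs
  have hψx : ContDiffAt ℝ 1 φ.symm (φ x) :=
    (hψ.contDiffAt (φ.open_target.mem_nhds hxt)).of_le (by norm_cast)
  obtain ⟨K, s, hs, hK⟩ := hψx.exists_lipschitzOnWith
  obtain ⟨ρ, hρ, hball⟩ := Metric.mem_nhds_iff.1 (inter_mem hs (φ.open_target.mem_nhds hxt))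
  have hφc : ContinuousAt φ x := φ.continuousAt hxs
  filter_upwards [self_mem_nhdsWithin, nhdsWithin_le_nhds (φ.open_source.mem_nhds hxs),
    nhdsWithin_le_nhds (hφc.eventually_mem (Metric.ball_mem_nhds _ hρ))] with z hzM hzs hzρ
  have hseg : ∀ t ∈ Icc (0 : ℝ) 1, φ x + t • (φ z - φ x) ∈ Metric.ball (φ x) ρ := fun t ht =>
    (convex_ball (φ x) ρ).add_smul_sub_mem (Metric.mem_ball_self hρ) hzρ ht
  have hline : LipschitzWith ‖φ z - φ x‖₊ (fun t : ℝ => φ x + t • (φ z - φ x)) :=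
    LipschitzWith.of_dist_le_mul fun s t => by
      rw [dist_add_left, dist_eq_norm, ← sub_smul, norm_smul, mul_comm]
      simp [Real.dist_eq]
  refine ⟨fun t => φ.symm (φ x + t • (φ z - φ x)),
    ⟨_, hK.comp hline.lipschitzOnWith fun t ht => (hball (hseg t ht)).1⟩,
    by simp [φ.left_inv hxs], by simp [φ.left_inv hzs], fun t ht => ?_⟩
  have htt := (hball (hseg t ht)).2
  rw [hV _ (φ.map_target htt), φ.right_inv htt]
  exact V.add_mem ((hV x hxs).1 hx) (V.smul_mem t (V.sub_mem ((hV z hzs).1 hzM) ((hV x hxs).1 hx)))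

theorem IsHomogeneousEmbedded.isRectifiablyConnected {m : ℕ} {M : Set (Amb m)}
    (hM : IsHomogeneousEmbedded M) : IsRectifiablyConnected M := by
  obtain ⟨d, hd⟩ := hM.submanifold
  intro x hx y hy
  exact hM.connected.isPreconnected.induction₂ (LipschitzJoined M)
    (fun x hx => hd.eventually_lipschitzJoined hx)
    (fun _ _ _ _ _ _ => LipschitzJoined.trans) (fun _ _ _ _ => LipschitzJoined.symm) hx hy

end LipschitzJoined

/-! ### Differential equations on compact sets -/

section ODE

open scoped NNReal

/-- A bounded Lipschitz map with values in a finite-dimensional space extends to a bounded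
Lipschitz map: extend coordinatewise, then clip the coordinates. -/
theorem exists_bounded_lipschitz_extension {E : Type*} [NormedAddCommGroup E] [NormedSpace ℝ E]
    [FiniteDimensional ℝ E] {α : Type*} [PseudoMetricSpace α] {s : Set α}
    {f : α → E} {K : ℝ≥0} (hf : LipschitzOnWith K f s) {B : ℝ} (hB : ∀ x ∈ s, ‖f x‖ ≤ B) :
    ∃ (g : α → E) (K' L : ℝ≥0), LipschitzWith K' g ∧ (∀ x, ‖g x‖ ≤ L) ∧ EqOn f g s := by
  let A := ContinuousLinearEquiv.ofFinrankEq
    (show Module.finrank ℝ E = Module.finrank ℝ (Fin (Module.finrank ℝ E) → ℝ) by simp)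
  have hAf := A.toContinuousLinearMap.lipschitz.comp_lipschitzOnWith hf
  obtain ⟨g, hg, hfg⟩ := hAf.extend_pi
  let R : ℝ := ‖A.toContinuousLinearMap‖ * |B|
  have hR : 0 ≤ R := by positivity
  let clip : (Fin (Module.finrank ℝ E) → ℝ) → (Fin (Module.finrank ℝ E) → ℝ) :=
    fun u i => max (-R) (min R (u i))
  have hclip : LipschitzWith 1 clip := by
    refine LipschitzWith.of_dist_le_mul fun u v => ?_
    rw [NNReal.coe_one, one_mul, dist_pi_le_iff dist_nonneg]
    intro i
    have h1 := (LipschitzWith.id.const_min R).const_max (-R) |>.dist_le_mul (u i) (v i)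
    simp only [NNReal.coe_one, one_mul, id] at h1
    exact h1.trans (dist_le_pi_dist u v i)
  have hclipR : ∀ u, ‖clip u‖ ≤ R := fun u => by
    rw [pi_norm_le_iff_of_nonneg hR]
    intro i
    rw [Real.norm_eq_abs, abs_le]
    exact ⟨le_max_left _ _, max_le (by linarith) (min_le_left _ _)⟩
  have hAs := A.symm.toContinuousLinearMap.lipschitz.comp (hclip.comp hg)
  refine ⟨_, _, ⟨‖A.symm.toContinuousLinearMap‖ * R, by positivity⟩, hAs, fun x => ?_, fun x hx => ?_⟩
  · refine (ContinuousLinearMap.le_opNorm _ _).trans ?_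
    exact mul_le_mul_of_nonneg_left (hclipR _) (norm_nonneg _)
  · have h1 : clip (g x) = g x := by
      have hb : ‖g x‖ ≤ R := by
        rw [← hfg hx]
        refine (ContinuousLinearMap.le_opNorm _ _).trans ?_
        exact mul_le_mul_of_nonneg_left ((hB x hx).trans (le_abs_self B)) (norm_nonneg _)
      ext i
      have hi := abs_le.1 ((norm_le_pi_norm (g x) i).trans hb)
      simp only [clip]
      rw [min_eq_right hi.2, max_eq_right hi.1]
    simp only [Function.comp_apply, h1]
    rw [← hfg hx]
    simp

/-- **Invariance** (Nagumo): a closed set to which a Lipschitz vector field is tangent is invariant.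
The distance to the set satisfies a differential inequality of Grönwall type. -/
theorem mem_of_tangent {E : Type*} [NormedAddCommGroup E] [NormedSpace ℝ E] [ProperSpace E]
    {S : Set E} (hS : IsClosed S) {F : E → E} {K : ℝ≥0}
    (hF : LipschitzWith K F)
    (htan : ∀ x ∈ S, ∃ γ : ℝ → E, γ 0 = x ∧ (∀ᶠ t in 𝓝 (0 : ℝ), γ t ∈ S) ∧
      HasDerivAt γ (F x) 0)
    {y : ℝ → E} {T : ℝ} (hy0 : y 0 ∈ S)
    (hy : ∀ t ∈ Icc 0 T, HasDerivWithinAt y (F (y t)) (Icc 0 T) t) :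
    ∀ t ∈ Icc 0 T, y t ∈ S := by
  have hne : S.Nonempty := ⟨_, hy0⟩
  have hyc : ContinuousOn y (Icc 0 T) := fun t ht => (hy t ht).continuousWithinAt
  have hmain := le_gronwallBound_of_liminf_deriv_right_le (f := fun t => Metric.infDist (y t) S)
    (f' := fun t => K * Metric.infDist (y t) S) (δ := 0) (K := K) (ε := 0) (a := 0) (b := T)
    ((Metric.continuous_infDist_pt S).comp_continuousOn hyc) ?_
    (Metric.infDist_zero_of_mem hy0).le (fun t _ => by simp)
  · intro t ht
    have h := hmain t ht
    rw [gronwallBound_ε0_δ0] at h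
    exact (hS.mem_iff_infDist_zero hne).2 (le_antisymm h Metric.infDist_nonneg)
  intro t ht r hr
  -- The solution is compared with the curve in `S` through a nearest point `p` of `S`.
  obtain ⟨p, hpS, hp⟩ := hS.exists_infDist_eq_dist hne (y t)
  obtain ⟨γ, hγ0, hγS, hγ⟩ := htan p hpS
  rw [hp] at hr ⊢
  set ε := (r - K * dist (y t) p) / 3 with hε
  have hεpos : 0 < ε := by rw [hε]; linarith
  have hyt : HasDerivWithinAt y (F (y t)) (Ioi t) t :=
    ((hy t ⟨ht.1, ht.2.le⟩).mono_of_mem_nhdsWithin (Icc_mem_nhdsGE_of_mem ht)).Ioi_of_Ici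
  have h1 := (hasDerivWithinAt_iff_isLittleO.1 hyt).bound hεpos
  have hshift : Tendsto (fun z : ℝ => z - t) (𝓝[>] t) (𝓝 0) := by
    have : Tendsto (fun z : ℝ => z - t) (𝓝 t) (𝓝 (t - t)) := tendsto_id.sub_const t
    rw [sub_self] at this
    exact this.mono_left nhdsWithin_le_nhds
  have h2 := hshift.eventually ((hasDerivAt_iff_isLittleO.1 hγ).bound hεpos)
  have h3 := hshift.eventually hγS
  refine (Eventually.frequently ?_)
  filter_upwards [h1, h2, h3, self_mem_nhdsWithin] with z hz1 hz2 hz3 hz4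
  have hzt : 0 < z - t := sub_pos.2 hz4
  rw [Real.norm_eq_abs, abs_of_pos hzt] at hz1
  rw [hγ0, sub_zero, Real.norm_eq_abs, abs_of_pos hzt] at hz2
  have h4 : ‖(z - t) • (F (y t) - F p)‖ ≤ (z - t) * (K * dist (y t) p) := by
    rw [norm_smul, Real.norm_eq_abs, abs_of_pos hzt, ← dist_eq_norm]
    gcongr
    exact hF.dist_le_mul _ _
  have h5 : Metric.infDist (y z) S ≤
      ε * (z - t) + ε * (z - t) + (z - t) * (K * dist (y t) p) + dist (y t) p := by
    refine (Metric.infDist_le_dist_of_mem hz3).trans ?_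
    have : y z - γ (z - t) = (y z - y t - (z - t) • F (y t)) - (γ (z - t) - p - (z - t) • F p) +
        (z - t) • (F (y t) - F p) + (y t - p) := by
      rw [smul_sub]; abel
    rw [dist_eq_norm, this, dist_eq_norm (y t) p]
    rw [dist_eq_norm] at h4
    refine (norm_add_le _ _).trans (add_le_add_left ((norm_add_le _ _).trans
      (add_le_add ((norm_sub_le _ _).trans (add_le_add hz1 hz2)) h4)) _)
  rw [inv_mul_lt_iff₀ hzt]
  have h6 : ε + ε + K * dist (y t) p < r := by rw [hε]; linarith
  nlinarith

/-- A Lipschitz vector field on a compact set to which it is tangent has solutions in this set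
for all positive times. -/
theorem exists_solution_of_tangent {E : Type*} [NormedAddCommGroup E] [NormedSpace ℝ E]
    [FiniteDimensional ℝ E] {S : Set E} (hS : IsCompact S) {F : E → E} {K : ℝ≥0}
    (hF : LipschitzOnWith K F S)
    (htan : ∀ x ∈ S, ∃ γ : ℝ → E, γ 0 = x ∧ (∀ᶠ t in 𝓝 (0 : ℝ), γ t ∈ S) ∧
      HasDerivAt γ (F x) 0) {x₀ : E} (hx₀ : x₀ ∈ S) :
    ∃ y : ℝ → E, y 0 = x₀ ∧ ∀ t, 0 ≤ t → y t ∈ S ∧ HasDerivWithinAt y (F (y t)) (Ici 0) t := by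
  have : ProperSpace E := FiniteDimensional.proper ℝ E
  obtain ⟨B, hB⟩ := hS.exists_bound_of_continuousOn hF.continuousOn
  obtain ⟨G, K', L, hG, hGL, hFG⟩ := exists_bounded_lipschitz_extension hF hB
  have htan' : ∀ x ∈ S, ∃ γ : ℝ → E, γ 0 = x ∧ (∀ᶠ t in 𝓝 (0 : ℝ), γ t ∈ S) ∧
      HasDerivAt γ (G x) 0 := fun x hx => hFG hx ▸ htan x hx
  have hloc : ∀ n : ℕ, ∃ y : ℝ → E, y 0 = x₀ ∧
      ∀ t ∈ Icc (0 : ℝ) n, HasDerivWithinAt y (G (y t)) (Icc 0 n) t := by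
    intro n
    have hpl : IsPicardLindelof (fun _ => G) (tmin := 0) (tmax := n) ⟨0, le_rfl, n.cast_nonneg⟩ x₀
        (L * n) 0 L K' :=
      ⟨fun _ _ => hG.lipschitzOnWith, fun _ _ => continuousOn_const, fun _ _ x _ => hGL x,
        by simp⟩
    exact hpl.exists_eq_forall_mem_Icc_hasDerivWithinAt₀
  choose y hy0 hy using hloc
  have huniq : ∀ n k : ℕ, n ≤ k → EqOn (y n) (y k) (Icc 0 n) := by
    intro n k hnk
    have hsub : Icc (0 : ℝ) n ⊆ Icc 0 k := Icc_subset_Icc_right (by exact_mod_cast hnk)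
    refine ODE_solution_unique (v := fun _ => G) (fun _ => hG)
      (fun t ht => (hy n t ht).continuousWithinAt)
      (fun t ht => (hy n t ⟨ht.1, ht.2.le⟩).mono_of_mem_nhdsWithin (Icc_mem_nhdsGE_of_mem ht))
      (fun t ht => ((hy k t (hsub ht)).mono hsub).continuousWithinAt)
      (fun t ht => ((hy k t (hsub ⟨ht.1, ht.2.le⟩)).mono hsub).mono_of_mem_nhdsWithin
        (Icc_mem_nhdsGE_of_mem ht)) (by rw [hy0, hy0])
  -- The solutions on `[0, n]` are glued together.
  have hglue : ∀ n : ℕ, ∀ t ∈ Icc (0 : ℝ) n, y (⌈t⌉₊) t = y n t := fun n t ht =>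
    huniq _ n (Nat.ceil_le.2 ht.2) ⟨ht.1, Nat.le_ceil t⟩
  refine ⟨fun t => y ⌈t⌉₊ t, hy0 _, fun t ht => ?_⟩
  have htn : t < (⌈t⌉₊ + 1 : ℕ) := by push_cast; linarith [Nat.le_ceil t]
  have hmem : t ∈ Icc (0 : ℝ) (⌈t⌉₊ + 1 : ℕ) := ⟨ht, htn.le⟩
  have hyS := mem_of_tangent hS.isClosed hG htan' (by rw [hy0]; exact hx₀) (hy (⌈t⌉₊ + 1)) t hmem
  dsimp only
  rw [hglue _ t hmem]
  refine ⟨hyS, ?_⟩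
  rw [hFG hyS]
  have hd := (hy (⌈t⌉₊ + 1) t hmem).congr (fun s hs => hglue _ s hs) (hglue _ t hmem)
  refine hd.mono_of_mem_nhdsWithin ?_
  rw [← Ici_inter_Iic]
  exact inter_mem self_mem_nhdsWithin (nhdsWithin_le_nhds (Iic_mem_nhds htn))

end ODE

/-! ### The interaction potential -/

section Potential

variable {m N : ℕ}

/-- The vector `∑ j, a_jk y_j` that agent `k` sees. -/
noncomputable def coupling (A : Matrix (Fin N) (Fin N) ℝ) (y : Fin N → Amb m) (k : Fin N) : Amb m :=
  ∑ j, A j k • y j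

/-- The potential `½ ∑ j k, a_jk ⟪y_j, y_k⟫`. On `M^N`, where the norm is constant, it differs by a
constant from `-¼ ∑ j k, a_jk ‖y_j - y_k‖²`. -/
noncomputable def potential (A : Matrix (Fin N) (Fin N) ℝ) (y : Fin N → Amb m) : ℝ :=
  1 / 2 * ∑ k, inner ℝ (y k) (coupling A y k)

variable {A : Matrix (Fin N) (Fin N) ℝ}

theorem coupling_add (y h : Fin N → Amb m) (k : Fin N) :
    coupling A (y + h) k = coupling A y k + coupling A h k := by
  simp [coupling, smul_add, Finset.sum_add_distrib]

theorem coupling_sub (y h : Fin N → Amb m) (k : Fin N) :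
    coupling A (y - h) k = coupling A y k - coupling A h k := by
  simp [coupling, smul_sub, Finset.sum_sub_distrib]

theorem norm_coupling_le (y : Fin N → Amb m) (k : Fin N) :
    ‖coupling A y k‖ ≤ (∑ i, ∑ j, |A j i|) * ‖y‖ := by
  have h1 : ‖coupling A y k‖ ≤ ∑ j, |A j k| * ‖y‖ := by
    refine (norm_sum_le _ _).trans (Finset.sum_le_sum fun j _ => ?_)
    rw [norm_smul, Real.norm_eq_abs]
    gcongr
    exact norm_le_pi_norm y j
  refine h1.trans ?_
  rw [← Finset.sum_mul]
  refine mul_le_mul_of_nonneg_right ?_ (norm_nonneg y)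
  exact Finset.single_le_sum (f := fun i => ∑ j, |A j i|)
    (fun i _ => Finset.sum_nonneg fun j _ => abs_nonneg _) (Finset.mem_univ k)

theorem sum_inner_coupling_comm (hA : A.IsSymm) (y h : Fin N → Amb m) :
    ∑ k, inner ℝ (y k) (coupling A h k) = ∑ k, inner ℝ (h k) (coupling A y k) := by
  simp only [coupling, inner_sum, inner_smul_right]
  rw [Finset.sum_comm]
  refine Finset.sum_congr rfl fun j _ => Finset.sum_congr rfl fun k _ => ?_
  rw [hA.apply, real_inner_comm]

theorem potential_add (hA : A.IsSymm) (y h : Fin N → Amb m) :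
    potential A (y + h) = potential A y + ∑ k, inner ℝ (h k) (coupling A y k) + potential A h := by
  have h1 := sum_inner_coupling_comm hA y h
  simp only [potential, coupling_add, Pi.add_apply, inner_add_left, inner_add_right,
    Finset.sum_add_distrib]
  rw [h1]
  ring

theorem abs_potential_le (h : Fin N → Amb m) :
    |potential A h| ≤ (1 / 2 * (N * ∑ i, ∑ j, |A j i|)) * ‖h‖ ^ 2 := by
  rw [potential, abs_mul, abs_of_pos (by norm_num : (0 : ℝ) < 1 / 2), mul_assoc (1 / 2 : ℝ)]
  gcongr
  calc |∑ k, inner ℝ (h k) (coupling A h k)| ≤ ∑ k, |inner ℝ (h k) (coupling A h k)| :=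
        Finset.abs_sum_le_sum_abs _ _
    _ ≤ ∑ _k : Fin N, ‖h‖ * ((∑ i, ∑ j, |A j i|) * ‖h‖) := by
        refine Finset.sum_le_sum fun k _ => (abs_real_inner_le_norm _ _).trans ?_
        gcongr
        · exact norm_le_pi_norm h k
        · exact norm_coupling_le h k
    _ = _ := by simp; ring

theorem potential_single (hA : IsUndirectedAdjacency A) (k : Fin N) (v : Amb m) :
    potential A (Pi.single k v) = 0 := by
  rw [potential, Finset.sum_eq_single k]
  · have : coupling A (Pi.single k v) k = 0 := by
      rw [coupling, Finset.sum_eq_single k]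
      · simp [hA.no_loops]
      · intro j _ hj
        simp [Pi.single_eq_of_ne hj]
      · simp
    simp [this]
  · intro j _ hj
    simp [Pi.single_eq_of_ne hj]
  · simp

/-- Since there are no loops, the potential is affine in the position of each agent. -/
theorem potential_update (hA : IsUndirectedAdjacency A) (y : Fin N → Amb m) (k : Fin N)
    (c : Amb m) :
    potential A (Function.update y k c) =
      potential A y + inner ℝ (c - y k) (coupling A y k) := by
  have h1 : Function.update y k c = y + Pi.single k (c - y k) := by
    ext1 j
    rcases eq_or_ne j k with rfl | hj
    · simp
    · simp [hj]
  rw [h1, potential_add hA.symm, potential_single hA, add_zero, Finset.sum_eq_single k]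
  · simp
  · intro j _ hj
    simp [Pi.single_eq_of_ne hj]
  · simp

theorem continuous_potential : Continuous (potential A : (Fin N → Amb m) → ℝ) := by
  unfold potential coupling
  fun_prop

theorem hasDerivWithinAt_potential (hA : A.IsSymm) {y : ℝ → Fin N → Amb m} {y' : Fin N → Amb m}
    {s : Set ℝ} {t : ℝ} (hy : ∀ k, HasDerivWithinAt (fun u => y u k) (y' k) s t) :
    HasDerivWithinAt (fun u => potential A (y u)) (∑ k, inner ℝ (y' k) (coupling A (y t) k))
      s t := by
  have hc : ∀ k, HasDerivWithinAt (fun u => coupling A (y u) k) (coupling A y' k) s t := fun k =>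
    HasDerivWithinAt.fun_sum fun j _ => (hy j).const_smul (A j k)
  have h := (HasDerivWithinAt.fun_sum (u := Finset.univ)
    fun k _ => (hy k).inner ℝ (hc k)).const_mul (1 / 2 : ℝ)
  refine h.congr_deriv ?_
  rw [Finset.sum_add_distrib, sum_inner_coupling_comm hA (y t) y']
  ring

end Potential

/-! ### The gradient field -/

section Field

variable {m N : ℕ} {M : Set (Amb m)} {A : Matrix (Fin N) (Fin N) ℝ} {α : ℝ}

theorem IsHomogeneousEmbedded.starProjection_self (hM : IsHomogeneousEmbedded M) (x : Amb m) :
    (tangentSpaceAt M x).starProjection x = 0 := by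
  rw [Submodule.starProjection_apply_eq_zero_iff, Submodule.mem_orthogonal']
  exact fun v hv => hM.inner_eq_zero hv

theorem IsHomogeneousEmbedded.gradientField_eq (hM : IsHomogeneousEmbedded M)
    (y : Fin N → Amb m) (k : Fin N) :
    gradientField M A α y k =
      (2 * α) • (tangentSpaceAt M (y k)).starProjection (coupling A y k) := by
  rw [gradientField]
  congr 1
  simp only [smul_sub, Finset.sum_sub_distrib, map_sub, ← Finset.sum_smul, map_smul,
    hM.starProjection_self, smul_zero, sub_zero, coupling]

theorem starProjection_coupling_eq_zero (hM : IsHomogeneousEmbedded M) (hα : α ≠ 0)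
    {y : Fin N → Amb m} (hy : y ∈ equilibria M A α) (k : Fin N) :
    (tangentSpaceAt M (y k)).starProjection (coupling A y k) = 0 := by
  have h := hy.2 k
  rw [hM.gradientField_eq, smul_eq_zero] at h
  exact h.resolve_left (by simpa using hα)

theorem isCompact_configurations (hM : IsHomogeneousEmbedded M) :
    IsCompact (configurations N M) := by
  have : configurations N M = Set.pi univ fun _ : Fin N => M := by
    ext y; simp [configurations]
  rw [this]
  exact isCompact_univ_pi fun _ => hM.compact

open scoped NNReal in
theorem exists_lipschitzOnWith_gradientField (hM : IsHomogeneousEmbedded M)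
    (A : Matrix (Fin N) (Fin N) ℝ) (α : ℝ) :
    ∃ K : ℝ≥0, LipschitzOnWith K (gradientField M A α) (configurations N M) := by
  obtain ⟨C, hC, hP⟩ := hM.starProjection_sub_le
  obtain ⟨R, hR⟩ := (isCompact_configurations (N := N) hM).isBounded.exists_norm_le
  set a := ∑ i, ∑ j, |A j i| with ha
  have ha0 : 0 ≤ a := Finset.sum_nonneg fun i _ => Finset.sum_nonneg fun j _ => abs_nonneg _
  refine ⟨NNReal.mk (|2 * α| * (C * (a * |R|) + a)) (by positivity),
    LipschitzOnWith.of_dist_le_mul fun y hy z hz => ?_⟩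
  rw [dist_eq_norm, dist_eq_norm, NNReal.coe_mk, pi_norm_le_iff_of_nonneg (by positivity)]
  intro k
  rw [Pi.sub_apply, hM.gradientField_eq, hM.gradientField_eq, ← smul_sub, norm_smul,
    Real.norm_eq_abs, mul_assoc]
  gcongr
  set P := (tangentSpaceAt M (y k)).starProjection
  set Q := (tangentSpaceAt M (z k)).starProjection
  have hk : ‖y k - z k‖ ≤ ‖y - z‖ := norm_le_pi_norm (y - z) k
  have h1 : P (coupling A y k) - Q (coupling A z k) =
      (P (coupling A y k) - Q (coupling A y k)) + Q (coupling A (y - z) k) := by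
    rw [coupling_sub, map_sub]; abel
  rw [h1, add_mul]
  refine (norm_add_le _ _).trans (add_le_add ?_ ?_)
  · refine (hP _ (hz k) _ (hy k) _).trans ?_
    have h2 : ‖coupling A y k‖ ≤ a * |R| := (norm_coupling_le y k).trans
      (mul_le_mul_of_nonneg_left ((hR y hy).trans (le_abs_self R)) ha0)
    calc C * ‖y k - z k‖ * ‖coupling A y k‖ ≤ C * ‖y - z‖ * (a * |R|) := by gcongr
      _ = _ := by ring
  · exact (Submodule.norm_starProjection_apply_le _ _).trans (norm_coupling_le _ _)

theorem exists_isSolution (hM : IsHomogeneousEmbedded M) (A : Matrix (Fin N) (Fin N) ℝ) (α : ℝ)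
    {y₀ : Fin N → Amb m} (hy₀ : y₀ ∈ configurations N M) :
    ∃ y, IsSolution M A α y ∧ y 0 = y₀ := by
  obtain ⟨K, hK⟩ := exists_lipschitzOnWith_gradientField hM A α
  obtain ⟨d, hd⟩ := hM.submanifold
  have htan : ∀ x ∈ configurations N M, ∃ γ : ℝ → Fin N → Amb m, γ 0 = x ∧
      (∀ᶠ t in 𝓝 (0 : ℝ), γ t ∈ configurations N M) ∧
      HasDerivAt γ (gradientField M A α x) 0 := by
    intro x hx
    have hT : ∀ k, gradientField M A α x k ∈ tangentSpaceAt M (x k) := fun k =>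
      Submodule.smul_mem _ _ (Submodule.starProjection_apply_mem _ _)
    choose γ h0 hγ hγd using fun k => hd.exists_curve (hx k) (hT k)
    exact ⟨fun t k => γ k t, funext h0, eventually_all.2 hγ, hasDerivAt_pi.2 hγd⟩
  obtain ⟨y, hy0, hy⟩ := exists_solution_of_tangent (isCompact_configurations hM) hK htan hy₀
  exact ⟨y, fun t ht => ⟨(hy t ht).1, hasDerivWithinAt_pi.1 (hy t ht).2⟩, hy0⟩

theorem inner_starProjection_self (K : Submodule ℝ (Amb m)) (u : Amb m) :
    inner ℝ (K.starProjection u) u = ‖K.starProjection u‖ ^ 2 := by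
  rw [← real_inner_self_eq_norm_sq, ← Submodule.inner_starProjection_left_eq_right,
    Submodule.starProjection_eq_self_iff.2 (K.starProjection_apply_mem u)]

/-- Along solutions `α` times the potential grows at least at half the squared speed. -/
theorem IsSolution.mul_potential_growth (hM : IsHomogeneousEmbedded M)
    (hA : A.IsSymm) {y : ℝ → Fin N → Amb m} (hy : IsSolution M A α y) {s t c : ℝ} (hs : 0 ≤ s)
    (hst : s ≤ t) (hc : 0 ≤ c) (hF : ∀ u ∈ Icc s t, c ≤ ‖gradientField M A α (y u)‖) :
    c ^ 2 / 2 * (t - s) ≤ α * potential A (y t) - α * potential A (y s) := by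
  have hd : ∀ u, 0 ≤ u → HasDerivWithinAt (fun u => α * potential A (y u))
      (α * ∑ k, inner ℝ (gradientField M A α (y u) k) (coupling A (y u) k)) (Ici 0) u :=
    fun u hu => (hasDerivWithinAt_potential hA (hy u hu).2).const_mul α
  have hval : ∀ u, α * ∑ k, inner ℝ (gradientField M A α (y u) k) (coupling A (y u) k) =
      1 / 2 * ∑ k, ‖gradientField M A α (y u) k‖ ^ 2 := by
    intro u
    rw [Finset.mul_sum, Finset.mul_sum]
    refine Finset.sum_congr rfl fun k _ => ?_
    rw [hM.gradientField_eq, norm_smul, inner_smul_left, mul_pow, Real.norm_eq_abs, sq_abs,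
      inner_starProjection_self]
    simp
    ring
  have hint : ∀ u ∈ Icc s t, c ^ 2 / 2 ≤ 1 / 2 * ∑ k, ‖gradientField M A α (y u) k‖ ^ 2 := by
    intro u hu
    have h0 : (0 : ℝ) ≤ ∑ k, ‖gradientField M A α (y u) k‖ ^ 2 :=
      Finset.sum_nonneg fun k _ => sq_nonneg _
    have h1 : ‖gradientField M A α (y u)‖ ≤ √(∑ k, ‖gradientField M A α (y u) k‖ ^ 2) := by
      rw [pi_norm_le_iff_of_nonneg (Real.sqrt_nonneg _)]
      intro k
      refine Real.le_sqrt_of_sq_le ?_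
      exact Finset.single_le_sum (f := fun k => ‖gradientField M A α (y u) k‖ ^ 2)
        (fun k _ => sq_nonneg _) (Finset.mem_univ k)
    have h2 := pow_le_pow_left₀ hc ((hF u hu).trans h1) 2
    rw [Real.sq_sqrt h0] at h2
    linarith
  have hsub : Icc s t ⊆ Ici 0 := fun u hu => hs.trans hu.1
  have hdi : ∀ u ∈ Ioo s t, HasDerivAt (fun u => α * potential A (y u))
      (α * ∑ k, inner ℝ (gradientField M A α (y u) k) (coupling A (y u) k)) u := fun u hu =>
    (hd u (hs.trans hu.1.le)).hasDerivAt (Ici_mem_nhds (hs.trans_lt hu.1))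
  refine (convex_Icc s t).mul_sub_le_image_sub_of_le_deriv
    (f := fun u => α * potential A (y u)) (fun u hu => ?_) (fun u hu => ?_) (fun u hu => ?_) s
    (left_mem_Icc.2 hst) t (right_mem_Icc.2 hst) hst
  · exact ((hd u (hsub hu)).mono hsub).continuousWithinAt
  · rw [interior_Icc] at hu
    exact (hdi u hu).differentiableAt.differentiableWithinAt
  · rw [interior_Icc] at hu
    rw [(hdi u hu).deriv, hval]
    exact hint u (Ioo_subset_Icc_self hu)

theorem IsSolution.mul_potential_mono (hM : IsHomogeneousEmbedded M) (hA : A.IsSymm)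
    {y : ℝ → Fin N → Amb m} (hy : IsSolution M A α y) {s t : ℝ} (hs : 0 ≤ s) (hst : s ≤ t) :
    α * potential A (y s) ≤ α * potential A (y t) := by
  have := hy.mul_potential_growth hM hA hs hst le_rfl fun _ _ => norm_nonneg _
  simpa using this

end Field

/-! ### Convergence to the set of equilibria -/

theorem exists_pos_forall_le_of_isCompact {X : Type*} [TopologicalSpace X] {K : Set X}
    (hK : IsCompact K) {f : X → ℝ} (hf : ContinuousOn f K) (hpos : ∀ x ∈ K, 0 < f x) :
    ∃ c > 0, ∀ x ∈ K, c ≤ f x := by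
  rcases K.eq_empty_or_nonempty with rfl | hne
  · exact ⟨1, one_pos, by simp⟩
  · obtain ⟨x, hx, hmin⟩ := hK.exists_isMinOn hne hf
    exact ⟨f x, hpos x hx, fun z hz => hmin hz⟩

section Convergence

variable {m N : ℕ} {M : Set (Amb m)} {A : Matrix (Fin N) (Fin N) ℝ} {α : ℝ}

/-- Away from the equilibria the speed stays above a constant during a time independent of the
starting point, so each visit there costs a definite amount of the bounded monotone quantity
`α * potential`. -/
theorem IsSolution.tendsto_equilibria (hM : IsHomogeneousEmbedded M) (hA : A.IsSymm)
    {y : ℝ → Fin N → Amb m} (hy : IsSolution M A α y) :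
    Tendsto y atTop (𝓝ˢ (equilibria M A α)) := by
  obtain ⟨K, hK⟩ := exists_lipschitzOnWith_gradientField hM A α
  have hcpt := isCompact_configurations (N := N) hM
  obtain ⟨B, hB⟩ := hcpt.exists_bound_of_continuousOn hK.continuousOn
  rw [(hasBasis_nhdsSet _).tendsto_right_iff]
  rintro U ⟨hUo, hU⟩
  obtain ⟨c, hc, hcF⟩ := exists_pos_forall_le_of_isCompact (hcpt.diff hUo)
    (hK.continuousOn.norm.mono sdiff_subset) (fun x hx => norm_pos_iff.2 fun h =>
      hx.2 (hU ⟨hx.1, fun k => congrFun h k⟩))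
  have hB0 : 0 ≤ B := (norm_nonneg _).trans (hB _ (hy 0 le_rfl).1)
  have hspeed : ∀ s t, 0 ≤ s → s ≤ t → ‖y t - y s‖ ≤ B * (t - s) := by
    intro s t hs hst
    have h := (convex_Ici (0 : ℝ)).norm_image_sub_le_of_norm_hasDerivWithin_le (f := y)
      (f' := fun u => gradientField M A α (y u)) (C := B)
      (fun u hu => hasDerivWithinAt_pi.2 (hy u hu).2) (fun u hu => hB _ (hy u hu).1)
      (show s ∈ Ici 0 from hs) (show t ∈ Ici 0 from hs.trans hst)
    rwa [Real.norm_eq_abs, abs_of_nonneg (sub_nonneg.2 hst)] at h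
  set τ : ℝ := c / (2 * (K * B + 1)) with hτ
  have hτ0 : 0 < τ := by positivity
  have hKτ : K * (B * τ) ≤ c / 2 := by
    have : (K * B + 1) * τ = c / 2 := by rw [hτ]; field_simp
    nlinarith
  have hgain : ∀ t, 0 ≤ t → y t ∉ U →
      (c / 2) ^ 2 / 2 * τ ≤ α * potential A (y (t + τ)) - α * potential A (y t) := by
    intro t ht htU
    have h := hy.mul_potential_growth hM hA ht (by linarith : t ≤ t + τ) (c := c / 2)
      (by positivity) fun u hu => ?_
    · simpa using h
    · have hu0 : 0 ≤ u := ht.trans hu.1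
      have h1 := hcF (y t) ⟨(hy t ht).1, htU⟩
      have h2 := hK.dist_le_mul _ (hy t ht).1 _ (hy u hu0).1
      rw [dist_comm (y t), dist_eq_norm, dist_eq_norm] at h2
      have h3 : (K : ℝ) * ‖y u - y t‖ ≤ K * (B * τ) := by
        gcongr
        refine (hspeed t u ht hu.1).trans ?_
        gcongr
        linarith [hu.2]
      have h4 := norm_le_insert' (gradientField M A α (y t)) (gradientField M A α (y u))
      linarith
  -- `max t 0` makes the monotone quantity monotone on the whole line.
  set W : ℝ → ℝ := fun t => α * potential A (y (max t 0)) with hW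
  have hWm : Monotone W := fun s t hst =>
    hy.mul_potential_mono hM hA (le_max_right _ _) (max_le_max_right 0 hst)
  obtain ⟨b, hb⟩ := (hcpt.image (continuous_const.mul continuous_potential :
    Continuous fun z => α * potential A z)).bddAbove
  have hWb : BddAbove (range W) := by
    refine ⟨b, ?_⟩
    rintro _ ⟨t, rfl⟩
    exact hb (mem_image_of_mem _ (hy _ (le_max_right _ _)).1)
  have hlim := tendsto_atTop_ciSup hWm hWb
  have hdiff : Tendsto (fun t => W (t + τ) - W t) atTop (𝓝 0) := by
    simpa using (hlim.comp (tendsto_atTop_add_const_right _ τ tendsto_id)).sub hlim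
  filter_upwards [hdiff.eventually_lt_const (show 0 < (c / 2) ^ 2 / 2 * τ by positivity),
    eventually_ge_atTop 0] with t ht ht0
  by_contra htU
  have h := hgain t ht0 htU
  simp only [hW] at ht
  rw [max_eq_left ht0, max_eq_left (by linarith)] at ht
  linarith

end Convergence

/-! ### Stable equilibria are local extrema of the potential -/

section Stability

variable {m N : ℕ} {M : Set (Amb m)} {A : Matrix (Fin N) (Fin N) ℝ} {α : ℝ}

/-- Equilibria are critical points of the potential on `M^N`. -/
theorem abs_potential_sub_le (hM : IsHomogeneousEmbedded M) (hA : A.IsSymm) (hα : α ≠ 0)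
    {y : Fin N → Amb m} (hy : y ∈ equilibria M A α) {ε : ℝ} (hε : 0 < ε) :
    ∃ δ > 0, ∀ z ∈ configurations N M, ‖z - y‖ < δ →
      |potential A z - potential A y| ≤ ε * ‖z - y‖ := by
  set b := ∑ k, ‖coupling A y k‖
  have hb : 0 ≤ b := Finset.sum_nonneg fun k _ => norm_nonneg _
  set C := 1 / 2 * (N * ∑ i, ∑ j, |A j i|)
  have hC : 0 ≤ C := mul_nonneg (by norm_num) (mul_nonneg N.cast_nonneg
    (Finset.sum_nonneg fun i _ => Finset.sum_nonneg fun j _ => abs_nonneg _))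
  obtain ⟨δ, hδ, h⟩ := hM.sub_starProjection_le (ε := ε / 2 / (b + 1)) (by positivity)
  refine ⟨min δ (ε / 2 / (C + 1)), by positivity, fun z hz hzy => ?_⟩
  set e := z - y with he
  have hz' : z = y + e := by rw [he]; abel
  rw [hz', potential_add hA]
  have h1 : ∀ k, |inner ℝ (e k) (coupling A y k)| ≤
      ε / 2 / (b + 1) * ‖e‖ * ‖coupling A y k‖ := by
    intro k
    set P := (tangentSpaceAt M (y k)).starProjection
    have hk : ‖e k‖ ≤ ‖e‖ := norm_le_pi_norm e k
    have h2 : inner ℝ (e k) (coupling A y k) = inner ℝ (e k - P (e k)) (coupling A y k) := by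
      rw [inner_sub_left, Submodule.inner_starProjection_left_eq_right,
        starProjection_coupling_eq_zero hM hα hy, inner_zero_right, sub_zero]
    rw [h2]
    refine (abs_real_inner_le_norm _ _).trans ?_
    gcongr
    refine (h (y k) (hy.1 k) (z k) (hz k)
      ((hk.trans_lt hzy).trans_le (min_le_left _ _))).trans ?_
    gcongr
    exact hk
  have h3 : |∑ k, inner ℝ (e k) (coupling A y k)| ≤ ε / 2 * ‖e‖ := by
    refine (Finset.abs_sum_le_sum_abs _ _).trans ((Finset.sum_le_sum fun k _ => h1 k).trans ?_)
    rw [← Finset.mul_sum]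
    have : ε / 2 / (b + 1) * b ≤ ε / 2 := by
      rw [div_mul_eq_mul_div, div_le_iff₀ (by positivity)]
      nlinarith
    calc ε / 2 / (b + 1) * ‖e‖ * b = ε / 2 / (b + 1) * b * ‖e‖ := by ring
      _ ≤ _ := by gcongr
  have h4 : |potential A e| ≤ ε / 2 * ‖e‖ := by
    refine (abs_potential_le e).trans ?_
    have h5 : C * ‖e‖ ≤ ε / 2 := by
      have h6 := (hzy.trans_le (min_le_right _ _)).le
      rw [le_div_iff₀ (by positivity)] at h6
      nlinarith [norm_nonneg e]
    calc C * ‖e‖ ^ 2 = C * ‖e‖ * ‖e‖ := by ring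
      _ ≤ _ := by gcongr
  have h7 := abs_add_le (∑ k, inner ℝ (e k) (coupling A y k)) (potential A e)
  rw [show potential A y + ∑ k, inner ℝ (e k) (coupling A y k) + potential A e - potential A y =
    ∑ k, inner ℝ (e k) (coupling A y k) + potential A e by ring]
  linarith

/-- Along a Lipschitz curve of critical points the potential has zero derivative. -/
theorem potential_eq_of_isRectifiablyConnected (hM : IsHomogeneousEmbedded M) (hA : A.IsSymm)
    (hα : α ≠ 0) {S : Set (Fin N → Amb m)} (hS : S ⊆ equilibria M A α)
    (hconn : IsRectifiablyConnected S) {y z : Fin N → Amb m} (hy : y ∈ S) (hz : z ∈ S) :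
    potential A y = potential A z := by
  obtain ⟨γ, ⟨K, hK⟩, h0, h1, hγ⟩ := hconn y hy z hz
  have hd : ∀ t ∈ Icc (0 : ℝ) 1,
      HasDerivWithinAt (fun s => potential A (γ s)) 0 (Icc 0 1) t := by
    intro t ht
    rw [hasDerivWithinAt_iff_isLittleO, Asymptotics.isLittleO_iff]
    intro c hc
    obtain ⟨δ, hδ, h⟩ := abs_potential_sub_le hM hA hα (hS (hγ t ht))
      (ε := c / (K + 1)) (by positivity)
    have hcont : ContinuousWithinAt γ (Icc 0 1) t := hK.continuousOn t ht
    filter_upwards [hcont.eventually (Metric.ball_mem_nhds (γ t) hδ), self_mem_nhdsWithin]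
      with s hs hsI
    rw [smul_zero, sub_zero, Real.norm_eq_abs]
    refine (h _ (hS (hγ s hsI)).1 (by rwa [← dist_eq_norm])).trans ?_
    have h2 := hK.dist_le_mul s hsI t ht
    rw [dist_eq_norm, dist_eq_norm] at h2
    calc c / (K + 1) * ‖γ s - γ t‖ ≤ c / (K + 1) * ((K + 1) * ‖s - t‖) := by
          gcongr
          exact h2.trans (by gcongr; simp)
      _ = c * ‖s - t‖ := by field_simp
  have hconst := constant_of_has_deriv_right_zero (f := fun s => potential A (γ s))
    (fun t ht => (hd t ht).continuousWithinAt)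
    (fun t ht => (hd t ⟨ht.1, ht.2.le⟩).mono_of_mem_nhdsWithin (Icc_mem_nhdsGE_of_mem ht))
    1 (right_mem_Icc.2 zero_le_one)
  simpa [h0, h1] using hconst.symm

/-- Around an asymptotically stable equilibrium, `α` times the potential is locally maximal: it
increases along solutions, which converge to a set on which it is constant. -/
theorem eventually_mul_potential_le (hM : IsHomogeneousEmbedded M) (hA : A.IsSymm)
    (hα : α ≠ 0) {y : Fin N → Amb m} (hy : IsAsymptoticallyStableEquilibrium M A α y) :
    ∀ᶠ z in 𝓝 y, z ∈ configurations N M → α * potential A z ≤ α * potential A y := by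
  obtain ⟨S, hyS, hSE, -, hconn, -, V, hV, hVS⟩ := hy
  have hVy : V ∈ 𝓝 y := nhds_le_nhdsSet hyS hV
  filter_upwards [hVy] with z hzV hz
  obtain ⟨s, hs, rfl⟩ := exists_isSolution hM A α hz
  have hlim := hVS s hs hzV
  refine le_of_forall_pos_lt_add fun ε hε => ?_
  have hopen : IsOpen {x : Fin N → Amb m | α * potential A x < α * potential A y + ε} :=
    isOpen_lt (continuous_const.mul continuous_potential) continuous_const
  have hmem : {x : Fin N → Amb m | α * potential A x < α * potential A y + ε} ∈ 𝓝ˢ S := by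
    rw [hopen.mem_nhdsSet]
    intro x hx
    rw [mem_ofPred_eq, potential_eq_of_isRectifiablyConnected hM hA hα hSE hconn hx hyS]
    linarith
  obtain ⟨t, ht, ht0⟩ := ((hlim.eventually hmem).and (eventually_ge_atTop 0)).exists
  exact (hs.mul_potential_mono hM hA le_rfl ht0).trans_lt ht

/-- At a local maximum of `α` times the potential each agent is at a local maximum of a linear
function over `M`. -/
theorem isMaxOn_of_isAsymptoticallyStableEquilibrium (hM : IsHomogeneousEmbedded M)
    (hM₂ : LinearLocalMaxAreGlobal M) (hA : IsUndirectedAdjacency A) (hα : α ≠ 0)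
    {y : Fin N → Amb m} (hy : IsAsymptoticallyStableEquilibrium M A α y) :
    y ∈ configurations N M ∧
      ∀ k, ∀ c ∈ M, α * inner ℝ c (coupling A y k) ≤ α * inner ℝ (y k) (coupling A y k) := by
  have hloc := eventually_mul_potential_le hM hA.symm hα hy
  obtain ⟨S, hyS, hSE, -⟩ := hy
  have hyM : y ∈ configurations N M := (hSE hyS).1
  refine ⟨hyM, fun k c hc => ?_⟩
  have hupd : Tendsto (fun c => Function.update y k c) (𝓝 (y k)) (𝓝 y) := by
    have : Continuous fun c => Function.update y k c := by fun_prop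
    simpa using this.tendsto (y k)
  have hmax : IsLocalMaxOn (fun z => inner ℝ z (α • coupling A y k)) M (y k) := by
    filter_upwards [nhdsWithin_le_nhds (hupd.eventually hloc), self_mem_nhdsWithin] with z hz hzM
    have h1 : Function.update y k z ∈ configurations N M := by
      intro j
      rcases eq_or_ne j k with rfl | hj
      · simpa using hzM
      · simpa [hj] using hyM j
    have h2 := hz h1
    rw [potential_update hA, inner_sub_left] at h2
    simp only [inner_smul_right]
    linarith
  have h := hM₂ _ _ (hyM k) hmax hc
  simpa only [mem_ofPred_eq, inner_smul_right] using h

end Stability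

/-! ### The equally weighted complete graph -/

section Complete

variable {m N : ℕ} {M : Set (Amb m)} {A : Matrix (Fin N) (Fin N) ℝ} {α w : ℝ}

theorem coupling_complete (hw : ∀ j k, A j k = if j = k then 0 else w) (y : Fin N → Amb m)
    (k : Fin N) : coupling A y k = w • (∑ j, y j - y k) := by
  have h : ∀ j, A j k • y j = w • y j - if j = k then w • y k else 0 := by
    intro j
    rw [hw]
    split_ifs with hj
    · simp [hj]
    · simp
  simp only [coupling, h, Finset.sum_sub_distrib, Finset.sum_ite_eq', Finset.mem_univ, if_true,
    smul_sub, Finset.smul_sum]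

/-- In a complete graph, adding the maximality conditions of `y_k` against `y_j` and of `y_j`
against `y_k` forces `y_j = y_k`. -/
theorem IsConsensus.isSynchronized (hM : IsHomogeneousEmbedded M) (hw0 : 0 < w)
    (hw : ∀ j k, A j k = if j = k then 0 else w) {y : Fin N → Amb m} (hy : IsConsensus M A y) :
    IsSynchronized y := by
  obtain ⟨r, hr⟩ := hM.norm_const
  have h : ∀ j k, inner ℝ (y j) (∑ i, y i - y k) ≤ inner ℝ (y k) (∑ i, y i - y k) := by
    intro j k
    have h1 := hy.2 k (hy.1 j)
    simp only [mem_ofPred_eq] at h1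
    rw [show ∑ j, A j k • y j = w • (∑ j, y j - y k) from coupling_complete hw y k,
      inner_smul_right, inner_smul_right] at h1
    exact le_of_mul_le_mul_left h1 hw0
  intro j k
  have h1 := h j k
  have h2 := h k j
  have hj := hr _ (hy.1 j)
  have hk := hr _ (hy.1 k)
  simp only [inner_sub_right, real_inner_self_eq_norm_sq, hj, hk] at h1 h2
  have h3 : ‖y j - y k‖ ^ 2 ≤ 0 := by
    rw [norm_sub_sq_real, hj, hk]
    linarith [real_inner_comm (y j) (y k)]
  have h4 : ‖y j - y k‖ = 0 := by nlinarith [norm_nonneg (y j - y k)]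
  exact sub_eq_zero.1 (norm_eq_zero.1 h4)

theorem inner_eq_of_mem (hM : IsHomogeneousEmbedded M) {x z : Amb m} (hx : x ∈ M) (hz : z ∈ M) :
    inner ℝ x (z - x) = -(‖z - x‖ ^ 2 / 2) := by
  obtain ⟨r, hr⟩ := hM.norm_const
  rw [norm_sub_sq_real, inner_sub_right, real_inner_self_eq_norm_sq, hr _ hx, hr _ hz,
    real_inner_comm]
  ring

/-- For the complete graph the equilibria close to the synchronized configurations are
synchronized. For a pair of agents `j`, `k` at maximal distance, the sum `s` of all positions
satisfies `⟪s, y_j - y_k⟫ ≤ -N/4 ‖y_j - y_k‖²`, and the same with `j` and `k` exchanged. -/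
theorem exists_isSynchronized_of_equilibrium (hM : IsHomogeneousEmbedded M) (hα : α ≠ 0)
    (hw0 : 0 < w) (hw : ∀ j k, A j k = if j = k then 0 else w) :
    ∃ δ > 0, ∀ y ∈ equilibria M A α, (∀ j k, ‖y j - y k‖ < δ) → IsSynchronized y := by
  -- Any constant below `1 / 2` would do in place of `1 / 4`.
  obtain ⟨δ, hδ, h⟩ := hM.sub_starProjection_le (ε := 1 / 4) (by norm_num)
  refine ⟨δ, hδ, fun y hy hyδ => ?_⟩
  rcases isEmpty_or_nonempty (Fin N) with hN | hN
  · exact fun j => hN.elim j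
  have hNpos : (0 : ℝ) < N := by exact_mod_cast Fin.pos_iff_nonempty.2 hN
  obtain ⟨⟨j, k⟩, hjk⟩ := Finite.exists_max fun p : Fin N × Fin N => ‖y p.1 - y p.2‖
  set D := ‖y j - y k‖ with hD
  have hmax : ∀ i l, ‖y i - y l‖ ≤ D := fun i l => hjk (i, l)
  set s := ∑ i, y i with hs
  have key : ∀ i l, ‖y i - y l‖ = D → inner ℝ s (y i - y l) ≤ -(N * D ^ 2 / 4) := by
    intro i l hil
    set P := (tangentSpaceAt M (y l)).starProjection
    set n := (y i - y l) - P (y i - y l) with hn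
    have hPs : P s = 0 := by
      have h1 := starProjection_coupling_eq_zero hM hα hy l
      rw [coupling_complete hw, map_smul, map_sub, hM.starProjection_self, sub_zero,
        smul_eq_zero] at h1
      exact h1.resolve_left hw0.ne'
    have h1 : inner ℝ s (y i - y l) = inner ℝ s n := by
      rw [hn, inner_sub_right s (y i - y l), ← Submodule.inner_starProjection_left_eq_right]
      change _ = _ - inner ℝ (P s) _
      rw [hPs, inner_zero_left, sub_zero]
    have h2 : inner ℝ (y l) (y i - y l) = inner ℝ (y l) n := by
      rw [hn, inner_sub_right (y l) (y i - y l), ← Submodule.inner_starProjection_left_eq_right,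
        hM.starProjection_self, inner_zero_left, sub_zero]
    have hsum : s = (N : ℝ) • y l + ∑ i, (y i - y l) := by
      simp [hs, Finset.sum_sub_distrib, Nat.cast_smul_eq_nsmul]
    have hnb : ‖n‖ ≤ 1 / 4 * D := by
      rw [← hil]
      exact h _ (hy.1 l) _ (hy.1 i) (hyδ i l)
    have h3 : inner ℝ (∑ i, (y i - y l)) n ≤ N * D * (1 / 4 * D) := by
      refine (real_inner_le_norm _ _).trans ?_
      gcongr
      refine (norm_sum_le _ _).trans ((Finset.sum_le_sum fun i _ => hmax i l).trans ?_)
      simp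
    rw [h1, hsum, inner_add_left, inner_smul_left, ← h2, inner_eq_of_mem hM (hy.1 l) (hy.1 i), hil]
    simp only [conj_trivial]
    linarith
  have h1 := key j k rfl
  have h2 := key k j (norm_sub_rev _ _)
  rw [← neg_sub (y j), inner_neg_right] at h2
  have h3 : N * D ^ 2 ≤ 0 := by linarith
  have hD0 : D ≤ 0 := by
    by_contra hcon
    push Not at hcon
    have : 0 < N * D ^ 2 := by positivity
    linarith
  intro i l
  exact sub_eq_zero.1 (norm_le_zero_iff.1 ((hmax i l).trans hD0))

theorem potential_eq_sub_sum (hM : IsHomogeneousEmbedded M) (A : Matrix (Fin N) (Fin N) ℝ) :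
    ∃ c : ℝ, ∀ y ∈ configurations N M,
      potential A y = c - 1 / 4 * ∑ k, ∑ j, A j k * ‖y j - y k‖ ^ 2 := by
  obtain ⟨r, hr⟩ := hM.norm_const
  refine ⟨1 / 2 * ∑ k, ∑ j, A j k * r ^ 2, fun y hy => ?_⟩
  have h : ∀ j k, ‖y j - y k‖ ^ 2 = 2 * r ^ 2 - 2 * inner ℝ (y k) (y j) := by
    intro j k
    rw [norm_sub_sq_real, hr _ (hy j), hr _ (hy k), real_inner_comm]
    ring
  simp only [potential, coupling, inner_sum, inner_smul_right, h, Finset.mul_sum,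
    ← Finset.sum_sub_distrib]
  refine Finset.sum_congr rfl fun k _ => Finset.sum_congr rfl fun j _ => by ring

theorem synchronized_subset_equilibria :
    {y | y ∈ configurations N M ∧ IsSynchronized y} ⊆ equilibria M A α := by
  rintro y ⟨hy, hs⟩
  exact ⟨hy, fun k => by simp [gradientField, fun j => hs j k]⟩

theorem isClosed_isSynchronized : IsClosed {y : Fin N → Amb m | IsSynchronized y} := by
  simp only [IsSynchronized, ofPred_forall]
  exact isClosed_iInter fun j => isClosed_iInter fun k =>
    isClosed_eq (continuous_apply j) (continuous_apply k)

theorem isRectifiablyConnected_synchronized (hM : IsHomogeneousEmbedded M) :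
    IsRectifiablyConnected {y : Fin N → Amb m | y ∈ configurations N M ∧ IsSynchronized y} := by
  rintro y ⟨hyM, hy⟩ z ⟨hzM, hz⟩
  rcases isEmpty_or_nonempty (Fin N) with hN | ⟨⟨k⟩⟩
  · exact ⟨fun _ => y, ⟨0, LipschitzOnWith.of_dist_le_mul fun _ _ _ _ => by simp⟩, rfl,
      Subsingleton.elim _ _, fun t _ => ⟨hyM, hy⟩⟩
  · obtain ⟨γ, ⟨K, hK⟩, h0, h1, hγ⟩ := hM.isRectifiablyConnected _ (hyM k) _ (hzM k)
    refine ⟨fun t _ => γ t, ⟨K, LipschitzOnWith.of_dist_le_mul fun s hs t ht => ?_⟩,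
      funext fun j => ?_, funext fun j => ?_, fun t ht => ⟨fun _ => hγ t ht, fun _ _ => rfl⟩⟩
    · exact (dist_pi_le_iff (by positivity)).2 fun _ => hK.dist_le_mul s hs t ht
    · exact h0.trans (hy k j)
    · exact h1.trans (hz k j)

/-- For the complete graph and `α > 0` the function `∑ j k, a_jk ‖y_j - y_k‖²` is a Lyapunov
function that vanishes exactly at the synchronized configurations. -/
theorem isLyapunovStable_synchronized (hM : IsHomogeneousEmbedded M)
    (hA : IsUndirectedAdjacency A) (hα : 0 < α) (hw0 : 0 < w)
    (hw : ∀ j k, A j k = if j = k then 0 else w) {U : Set (Fin N → Amb m)}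
    (hU : U ∈ 𝓝ˢ {y : Fin N → Amb m | y ∈ configurations N M ∧ IsSynchronized y}) :
    ∃ V ∈ 𝓝ˢ {y : Fin N → Amb m | y ∈ configurations N M ∧ IsSynchronized y},
      ∀ y, IsSolution M A α y → y 0 ∈ V → ∀ t, 0 ≤ t → y t ∈ U := by
  obtain ⟨c₀, hc₀⟩ := potential_eq_sub_sum hM A
  obtain ⟨O, hO, hSO, hOU⟩ := mem_nhdsSet_iff_exists.1 hU
  set D : (Fin N → Amb m) → ℝ := fun y => ∑ k, ∑ j, A j k * ‖y j - y k‖ ^ 2 with hDdef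
  have hDc : Continuous D := by rw [hDdef]; fun_prop
  have hterm : ∀ (y : Fin N → Amb m) j k, 0 ≤ A j k * ‖y j - y k‖ ^ 2 := fun y j k =>
    mul_nonneg (hA.nonneg j k) (sq_nonneg _)
  have hpos : ∀ y ∈ configurations N M \ O, 0 < D y := by
    rintro y ⟨hyM, hyO⟩
    have hns : ¬ IsSynchronized y := fun h => hyO (hSO ⟨hyM, h⟩)
    simp only [IsSynchronized, not_forall] at hns
    obtain ⟨j, k, hjk⟩ := hns
    refine Finset.sum_pos' (fun k _ => Finset.sum_nonneg fun j _ => hterm y j k)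
      ⟨k, Finset.mem_univ k, Finset.sum_pos' (fun j _ => hterm y j k) ⟨j, Finset.mem_univ j, ?_⟩⟩
    have hne : j ≠ k := fun h => hjk (h ▸ rfl)
    have : 0 < ‖y j - y k‖ := norm_pos_iff.2 (sub_ne_zero.2 hjk)
    rw [hw, if_neg hne]
    positivity
  obtain ⟨c, hc, hcD⟩ := exists_pos_forall_le_of_isCompact
    ((isCompact_configurations (N := N) hM).diff hO) hDc.continuousOn hpos
  refine ⟨{y | D y < c}, ?_, fun y hy hy0 t ht => hOU ?_⟩
  · rw [(isOpen_lt hDc continuous_const).mem_nhdsSet]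
    rintro y ⟨-, hs⟩
    have : D y = 0 := Finset.sum_eq_zero fun k _ => Finset.sum_eq_zero fun j _ => by
      simp [hs j k]
    rw [mem_ofPred_eq, this]
    exact hc
  · by_contra hyt
    have h1 := hcD (y t) ⟨(hy t ht).1, hyt⟩
    have h2 := le_of_mul_le_mul_left (hy.mul_potential_mono hM hA.symm le_rfl ht) hα
    rw [hc₀ _ (hy 0 le_rfl).1, hc₀ _ (hy t ht).1] at h2
    rw [mem_ofPred_eq] at hy0
    change c ≤ ∑ k, ∑ j, A j k * ‖y t j - y t k‖ ^ 2 at h1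
    change ∑ k, ∑ j, A j k * ‖y 0 j - y 0 k‖ ^ 2 < c at hy0
    linarith

theorem isAsymptoticallyStableSet_synchronized (hM : IsHomogeneousEmbedded M)
    (hA : IsUndirectedAdjacency A) (hα : 0 < α) (hw0 : 0 < w)
    (hw : ∀ j k, A j k = if j = k then 0 else w) :
    IsAsymptoticallyStableSet M A α
      {y : Fin N → Amb m | y ∈ configurations N M ∧ IsSynchronized y} := by
  refine ⟨fun U hU => isLyapunovStable_synchronized hM hA hα hw0 hw hU, ?_⟩
  obtain ⟨δ, hδ, hiso⟩ := exists_isSynchronized_of_equilibrium (N := N) (A := A) hM hα.ne' hw0 hw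
  -- Solutions starting nearby never leave the closed set `C`, whose equilibria are synchronized.
  set C : Set (Fin N → Amb m) := {y | ∀ j k, ‖y j - y k‖ ≤ δ / 2}
  have hCc : IsClosed C := by
    simp only [C, ofPred_forall]
    exact isClosed_iInter fun j => isClosed_iInter fun k =>
      isClosed_le (by fun_prop) continuous_const
  have hC : C ∈ 𝓝ˢ {y : Fin N → Amb m | y ∈ configurations N M ∧ IsSynchronized y} := by
    rw [mem_nhdsSet_iff_forall]
    rintro y ⟨-, hs⟩
    have h : ∀ j k, ∀ᶠ z in 𝓝 y, ‖z j - z k‖ ≤ δ / 2 := by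
      intro j k
      have hc : Continuous fun z : Fin N → Amb m => ‖z j - z k‖ := by fun_prop
      refine (hc.tendsto y).eventually_le_const ?_
      simp only [hs j k, sub_self, norm_zero]
      positivity
    exact eventually_all.2 fun j => eventually_all.2 fun k => h j k
  obtain ⟨V, hV, hVC⟩ := isLyapunovStable_synchronized hM hA hα hw0 hw hC
  refine ⟨V, hV, fun y hy hy0 => ?_⟩
  rw [(hasBasis_nhdsSet _).tendsto_right_iff]
  rintro O ⟨hO, hSO⟩
  have hmem : O ∪ Cᶜ ∈ 𝓝ˢ (equilibria M A α) := by
    rw [(hO.union hCc.isOpen_compl).mem_nhdsSet]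
    intro z hz
    by_cases hzC : z ∈ C
    · exact Or.inl (hSO ⟨hz.1, hiso z hz fun j k => (hzC j k).trans_lt (by linarith)⟩)
    · exact Or.inr hzC
  filter_upwards [(hy.tendsto_equilibria hM hA.symm).eventually hmem, eventually_ge_atTop 0]
    with t ht ht0
  exact ht.resolve_right (not_not.2 (hVC y hy hy0 t ht0))

theorem isAsymptoticallyStableEquilibrium_of_isSynchronized (hM : IsHomogeneousEmbedded M)
    (hA : IsUndirectedAdjacency A) (hα : 0 < α) (hw0 : 0 < w)
    (hw : ∀ j k, A j k = if j = k then 0 else w) {y : Fin N → Amb m}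
    (hyM : y ∈ configurations N M) (hy : IsSynchronized y) :
    IsAsymptoticallyStableEquilibrium M A α y :=
  ⟨{y | y ∈ configurations N M ∧ IsSynchronized y}, ⟨hyM, hy⟩, synchronized_subset_equilibria,
    (isCompact_configurations hM).inter_right isClosed_isSynchronized,
    isRectifiablyConnected_synchronized hM,
    isAsymptoticallyStableSet_synchronized hM hA hα hw0 hw⟩

end Complete

end ManifoldConsensus

theorem proposition7 {m N : ℕ} (M : Set (Amb m))
    (hM₁ : IsHomogeneousEmbedded M) (hM₂ : LinearLocalMaxAreGlobal M)
    (A : Matrix (Fin N) (Fin N) ℝ) (hA : IsUndirectedAdjacency A) (α : ℝ) :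
    (∀ y₀ ∈ configurations N M, ∃ y, IsSolution M A α y ∧ y 0 = y₀) ∧
    (∀ y, IsSolution M A α y → Tendsto y atTop (𝓝ˢ (equilibria M A α))) ∧
    (α < 0 → ∀ y, IsAsymptoticallyStableEquilibrium M A α y → IsAntiConsensus M A y) ∧
    (0 < α → ∀ y, IsAsymptoticallyStableEquilibrium M A α y → IsConsensus M A y) ∧
    (0 < α → IsEquallyWeightedComplete A →
      ∀ y, IsAsymptoticallyStableEquilibrium M A α y ↔
        y ∈ configurations N M ∧ IsSynchronized y) := by
  have hcons : 0 < α → ∀ y, IsAsymptoticallyStableEquilibrium M A α y → IsConsensus M A y := by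
    intro hα y hy
    obtain ⟨hyM, h⟩ := isMaxOn_of_isAsymptoticallyStableEquilibrium hM₁ hM₂ hA hα.ne' hy
    exact ⟨hyM, fun k c hc => le_of_mul_le_mul_left (h k c hc) hα⟩
  refine ⟨fun y₀ hy₀ => exists_isSolution hM₁ A α hy₀,
    fun y hy => hy.tendsto_equilibria hM₁ hA.symm, fun hα y hy => ?_, hcons, ?_⟩
  · obtain ⟨hyM, h⟩ := isMaxOn_of_isAsymptoticallyStableEquilibrium hM₁ hM₂ hA hα.ne hy
    exact ⟨hyM, fun k c hc => (mul_le_mul_left_of_neg hα).1 (h k c hc)⟩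
  · rintro hα ⟨w, hw0, hw⟩ y
    refine ⟨fun hy => ?_, fun hy =>
      isAsymptoticallyStableEquilibrium_of_isSynchronized hM₁ hA hα hw0 hw hy.1 hy.2⟩
    have hc := hcons hα y hy
    exact ⟨hc.1, hc.isSynchronized hM₁ hw0 hw⟩
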